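/- **Theorem.** Let $k$ be a field and let $E=(E^0,E^1,\mathbf s,\mathbf r)$ be an arbitrary directed graph (loops and multiple edges allowed, no cardinality restrictions) with $E^0\neq\emptyset$. Let $L_k(E)$ be the Leavitt path algebra of $E$, that is, the (not necessarily unital) associative $k$-algebra generated by a set $\{v\mid v\in E^0\}$ of pairwise orthogonal idempotents together with elements $\{e,e^*\mid e\in E^1\}$ subject to the relations 1. $\mathbf s(e)e=e=e\,\mathbf r(e)$ for all $e\in E^1$; 2. $\mathbf r(e)e^*=e^*=e^*\mathbf s(e)$ for all $e\in E^1$; 3. $e^*e'=\delta_{e,e'}\mathbf r(e)$ for all $e,e'\in E^1$; 4. $v=\sum_{e\in\mathbf s^{-1}(v)}ee^*$ for every $v\in E^0$ with $\mathbf s^{-1}(v)$ finite and non-empty. For $u,v\in E^0$ write $u\geq v$ if there is a (possibly empty) directed path from $u$ to $v$. Then $L_k(E)$ is primitive (i.e., has a faithful irreducible representation) if and only if all of the following hold: 1. $E$ satisfies condition (L): every cycle (simple closed directed path of positive length) has an exit, i.e., contains a vertex that is the source of at least two edges; 2. $E$ is downward directed: for all $u,v\in E^0$ there is $w\in E^0$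 with $u\geq w$ and $v\geq w$; 3. $E$ has the countable separation property: there is a countable (finite or countably infinite) set $X\subseteq E^0$ such that for every $v\in E^0$ there is $x\in X$ with $v\geq x$. -/

import Mathlib

open Quiver

universe u v w

section PrimitiveRings

/-- A (possibly non-unital) ring `A` is (left) primitive if it has a faithful irreducible
representation: an additive group `M` with an action of `A` by additive endomorphisms such that
only `0` annihilates `M` (faithfulness), the action is nonzero, and the only `A`-stable
subgroups of `M` are `0` and `M`. -/
def IsPrimitiveRing (A : Type u) [NonUnitalRing A] : Prop :=
  ∃ (M : Type u) (_ : AddCommGroup M) (ρ : A →ₙ+* AddMonoid.End M),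
    Function.Injective ρ ∧
    (∃ (a : A) (m : M), ρ a m ≠ 0) ∧
    ∀ N : AddSubgroup M, (∀ (a : A), ∀ m ∈ N, ρ a m ∈ N) → N = ⊥ ∨ N = ⊤

end PrimitiveRings

section Graphs

variable (V : Type u) [Quiver.{v} V]

/-- `p` is a cycle: a simple closed directed path of positive length, i.e. its vertices are
distinct apart from the coincidence of its two endpoints. -/
def IsGraphCycle {V : Type u} [Quiver.{v} V] {a : V} (p : Path a a) : Prop :=
  0 < p.length ∧ p.vertices.dropLast.Nodup

/-- `p` has an exit: some vertex on `p` is the source of at least two edges. -/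
def HasExit {V : Type u} [Quiver.{v} V] {a b : V} (p : Path a b) : Prop :=
  ∃ x ∈ p.vertices, ∃ e f : Total V, e.left = x ∧ f.left = x ∧ e ≠ f

/-- Condition (L): every cycle has an exit. -/
def ConditionL : Prop :=
  ∀ (a : V) (p : Path a a), IsGraphCycle p → HasExit p

/-- Any two vertices `x`, `y` have (possibly empty) directed paths to a common vertex. -/
def IsDownwardDirectedGraph : Prop :=
  ∀ x y : V, ∃ z : V, Nonempty (Path x z) ∧ Nonempty (Path y z)

/-- There is a countable set of vertices such that each vertex has a (possibly empty) directed
path to a member of the set. -/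
def CountableSeparationProperty : Prop :=
  ∃ X : Set V, X.Countable ∧ ∀ y : V, ∃ x ∈ X, Nonempty (Path y x)

end Graphs

section LeavittPathAlgebras

/-- The generators of the Leavitt path algebra: the vertices `x`, the edges `e` and the ghost
edges `e*`. -/
inductive LeavittGen (V : Type u) [Quiver.{v} V] : Type (max u v)
  | vertex (x : V) : LeavittGen V
  | edge (e : Total V) : LeavittGen V
  | ghost (e : Total V) : LeavittGen V

variable (R : Type w) [CommRing R] (V : Type u) [Quiver.{v} V]

/-- The free non-unital associative `R`-algebra on the generators. -/
abbrev FreeLeavitt : Type (max u v w) := MonoidAlgebra R (FreeSemigroup (LeavittGen V))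

namespace FreeLeavitt

variable {V}

noncomputable def vertex (x : V) : FreeLeavitt R V :=
  MonoidAlgebra.single (FreeSemigroup.of (LeavittGen.vertex x)) 1

noncomputable def edge (e : Total V) : FreeLeavitt R V :=
  MonoidAlgebra.single (FreeSemigroup.of (LeavittGen.edge e)) 1

noncomputable def ghost (e : Total V) : FreeLeavitt R V :=
  MonoidAlgebra.single (FreeSemigroup.of (LeavittGen.ghost e)) 1

end FreeLeavitt

open FreeLeavitt in
/-- The defining relations of the Leavitt path algebra. For an edge `e`, `e.left` is its source
and `e.right` its range. -/
inductive LeavittRel : FreeLeavitt R V → FreeLeavitt R V → Prop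
  | vertex_idem (x : V) : LeavittRel (vertex R x * vertex R x) (vertex R x)
  | vertex_orth (x y : V) (h : x ≠ y) : LeavittRel (vertex R x * vertex R y) 0
  | source_edge (e : Total V) : LeavittRel (vertex R e.left * edge R e) (edge R e)
  | edge_range (e : Total V) : LeavittRel (edge R e * vertex R e.right) (edge R e)
  | range_ghost (e : Total V) : LeavittRel (vertex R e.right * ghost R e) (ghost R e)
  | ghost_source (e : Total V) : LeavittRel (ghost R e * vertex R e.left) (ghost R e)
  | ghost_edge_self (e : Total V) : LeavittRel (ghost R e * edge R e) (vertex R e.right)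
  | ghost_edge_ne (e f : Total V) (h : e ≠ f) : LeavittRel (ghost R e * edge R f) 0
  | sum_edge_ghost (x : V) (hne : {e : Total V | e.left = x}.Nonempty)
      (hfin : {e : Total V | e.left = x}.Finite) :
      LeavittRel (vertex R x) (∑ e ∈ hfin.toFinset, edge R e * ghost R e)

/-- The algebra congruence generated by the defining relations. As the free algebra has no unit,
the relations are closed under scalar multiples before the ring congruence is generated. -/
noncomputable def leavittCon : RingCon (FreeLeavitt R V) :=
  ringConGen fun a b => ∃ (c : R) (a' b' : FreeLeavitt R V),
    LeavittRel R V a' b' ∧ a = c • a' ∧ b = c • b'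

variable {R V} in
theorem leavittCon_smul (c : R) {a b : FreeLeavitt R V} (h : leavittCon R V a b) :
    leavittCon R V (c • a) (c • b) := by
  have key : ∀ x y : FreeLeavitt R V,
      RingConGen.Rel (fun a b => ∃ (c : R) (a' b' : FreeLeavitt R V),
        LeavittRel R V a' b' ∧ a = c • a' ∧ b = c • b') x y →
      leavittCon R V (c • x) (c • y) := by
    intro x y hxy
    induction hxy with
    | of x y h =>
      obtain ⟨d, a', b', hr, rfl, rfl⟩ := h
      exact RingConGen.Rel.of _ _ ⟨c * d, a', b', hr, smul_smul _ _ _, smul_smul _ _ _⟩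
    | refl x => exact (leavittCon R V).refl _
    | symm _ ih => exact (leavittCon R V).symm ih
    | trans _ _ ih₁ ih₂ => exact (leavittCon R V).trans ih₁ ih₂
    | add _ _ ih₁ ih₂ =>
      rw [smul_add, smul_add]
      exact (leavittCon R V).add ih₁ ih₂
    | mul _ h₂ ih₁ _ =>
      rw [← smul_mul_assoc, ← smul_mul_assoc]
      exact (leavittCon R V).mul ih₁ h₂
  exact key a b h

/-- The Leavitt path algebra `L_R(V)`: the non-unital associative `R`-algebra generated by the
vertices, edges and ghost edges of `V`, subject to the relations `LeavittRel`. -/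
def LeavittPathAlgebra : Type (max u v w) := (leavittCon R V).Quotient

namespace LeavittPathAlgebra

noncomputable instance : NonUnitalRing (LeavittPathAlgebra R V) :=
  inferInstanceAs (NonUnitalRing (leavittCon R V).Quotient)

variable {V} in
/-- The quotient map from the free algebra. -/
noncomputable def mk : FreeLeavitt R V → LeavittPathAlgebra R V := fun a => ((a : (leavittCon R V).Quotient))

noncomputable instance : SMul R (LeavittPathAlgebra R V) where
  smul c := Quotient.map' (c • ·) fun _ _ h => leavittCon_smul c h

variable {R V}

theorem mk_surjective : Function.Surjective (mk R (V := V)) := Quotient.mk''_surjective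

theorem mk_add (a b : FreeLeavitt R V) : mk R (a + b) = mk R a + mk R b := rfl

theorem mk_mul (a b : FreeLeavitt R V) : mk R (a * b) = mk R a * mk R b := rfl

theorem mk_zero : mk R (0 : FreeLeavitt R V) = 0 := rfl

theorem mk_smul (c : R) (a : FreeLeavitt R V) : mk R (c • a) = c • mk R a := rfl

noncomputable instance : Module R (LeavittPathAlgebra R V) where
  one_smul a := by
    obtain ⟨a, rfl⟩ := mk_surjective a
    rw [← mk_smul, one_smul]
  mul_smul c d a := by
    obtain ⟨a, rfl⟩ := mk_surjective a
    rw [← mk_smul, ← mk_smul, ← mk_smul, mul_smul]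
  smul_zero c := by rw [← mk_zero, ← mk_smul, smul_zero]
  smul_add c a b := by
    obtain ⟨a, rfl⟩ := mk_surjective a
    obtain ⟨b, rfl⟩ := mk_surjective b
    rw [← mk_add, ← mk_smul, ← mk_smul, ← mk_smul, ← mk_add, smul_add]
  add_smul c d a := by
    obtain ⟨a, rfl⟩ := mk_surjective a
    rw [← mk_smul, ← mk_smul, ← mk_smul, ← mk_add, add_smul]
  zero_smul a := by
    obtain ⟨a, rfl⟩ := mk_surjective a
    rw [← mk_smul, zero_smul, mk_zero]

instance : IsScalarTower R (LeavittPathAlgebra R V) (LeavittPathAlgebra R V) where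
  smul_assoc c a b := by
    obtain ⟨a, rfl⟩ := mk_surjective a
    obtain ⟨b, rfl⟩ := mk_surjective b
    rw [smul_eq_mul, smul_eq_mul, ← mk_smul, ← mk_mul, ← mk_mul, ← mk_smul, smul_mul_assoc]

instance : SMulCommClass R (LeavittPathAlgebra R V) (LeavittPathAlgebra R V) where
  smul_comm c a b := by
    obtain ⟨a, rfl⟩ := mk_surjective a
    obtain ⟨b, rfl⟩ := mk_surjective b
    rw [smul_eq_mul, smul_eq_mul, ← mk_smul, ← mk_mul, ← mk_mul, ← mk_smul, mul_smul_comm]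

end LeavittPathAlgebra

end LeavittPathAlgebras

/-!
Paths are encoded as lists of edges together with their last vertex, and `L_k(V)` is spanned by the
monomials `p q*` with `p`, `q` paths with a common range. A concrete representation, on a free
module whose basis is partitioned over the vertices compatibly with the edges and graded by an
integer, shows that vertices are nonzero and that distinct paths are linearly independent (`rep`,
`rep_linearCombination`).

*Necessity.* Let `M` be a faithful irreducible representation.

* Vertices `x`, `y` act as nonzero operators, so irreducibility gives `a` with `x a y ≠ 0`; a
  monomial of `a` surviving in `x a y` provides paths from `x` and `y` to a common vertex.
* Fix `m ≠ 0` in `M`. For each vertex `u`, some `a u b` fixes `m`, and it is a combination of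
  monomials `p q*` whose range is reachable from `u`. So `u` reaches the range of some `q` with
  `q* m ≠ 0`. If there are finitely many such `q` of each length, their ranges are the
  required countable set. Otherwise take the first length `n` at which there are infinitely many:
  the ranges of the shorter ones suffice, because a vertex `u` reaching none of them would leave
  only the initial segments of the finitely many paths `p` in `a u b` as candidates for `q` of
  length `n` (`finite_ghostElt_mul_apply_ne_zero`).
* If a cycle `c` at `x` has no exit, there is one path of each length starting at `x`, and the
  corner `x L_k(V) x` is commutative (`IsNoExitSet.corner_comm`). As it acts irreducibly and
  faithfully on `x M`, the nonzero element `x - c` would be invertible in it. But `x` and `c` have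
  the same composite with the sum of coefficients on the concrete representation, a contradiction.

*Sufficiency.* Under condition (L) every nonzero two-sided ideal contains a vertex
(`exists_mul_mul_eq_vtx`). Downward directedness and countable separation give a sequence of paths
`p₀, p₁, …`, each extending the preceding one, such that every vertex reaches one of
their ranges. The left ideal of the elements annihilated by right multiplication by some `pₙ` is
proper, modular, and comaximal with every nonzero two-sided ideal, so the quotient by a
maximal left ideal containing it is faithful and irreducible (`isPrimitiveRing_of_leftIdeal`).
-/

namespace LeavittPathAlgebra

/-! ### Generators and local units -/

section Basic

variable (k : Type w) [CommRing k] {V : Type u} [Quiver.{v} V]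

/-- The vertex idempotent of `L_k(V)`. -/
noncomputable def vtx (x : V) : LeavittPathAlgebra k V := mk k (FreeLeavitt.vertex k x)

/-- The image of an edge in `L_k(V)`. -/
noncomputable def edg (e : Total V) : LeavittPathAlgebra k V := mk k (FreeLeavitt.edge k e)

/-- The image of a ghost edge in `L_k(V)`. -/
noncomputable def gst (e : Total V) : LeavittPathAlgebra k V := mk k (FreeLeavitt.ghost k e)

variable {k}

theorem mk_eq_of_rel {a b : FreeLeavitt k V} (h : LeavittRel k V a b) : mk k a = mk k b :=
  Quotient.sound (RingConGen.Rel.of _ _ ⟨1, a, b, h, (one_smul _ _).symm, (one_smul _ _).symm⟩)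

theorem mk_sum {ι : Type*} (s : Finset ι) (f : ι → FreeLeavitt k V) :
    mk k (∑ i ∈ s, f i) = ∑ i ∈ s, mk k (f i) :=
  map_sum (⟨⟨mk k, mk_zero⟩, mk_add⟩ : FreeLeavitt k V →+ LeavittPathAlgebra k V) f s

theorem vtx_mul_self (x : V) : vtx k x * vtx k x = vtx k x := mk_eq_of_rel (.vertex_idem x)

theorem vtx_mul_vtx_of_ne {x y : V} (h : x ≠ y) : vtx k x * vtx k y = 0 :=
  mk_eq_of_rel (.vertex_orth x y h)

theorem vtx_mul_edg (e : Total V) : vtx k e.left * edg k e = edg k e :=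
  mk_eq_of_rel (.source_edge e)

theorem edg_mul_vtx (e : Total V) : edg k e * vtx k e.right = edg k e :=
  mk_eq_of_rel (.edge_range e)

theorem vtx_mul_gst (e : Total V) : vtx k e.right * gst k e = gst k e :=
  mk_eq_of_rel (.range_ghost e)

theorem gst_mul_vtx (e : Total V) : gst k e * vtx k e.left = gst k e :=
  mk_eq_of_rel (.ghost_source e)

theorem gst_mul_edg_self (e : Total V) : gst k e * edg k e = vtx k e.right :=
  mk_eq_of_rel (.ghost_edge_self e)

theorem gst_mul_edg_of_ne {e f : Total V} (h : e ≠ f) : gst k e * edg k f = 0 :=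
  mk_eq_of_rel (.ghost_edge_ne e f h)

theorem vtx_eq_sum (x : V) (hne : {e : Total V | e.left = x}.Nonempty)
    (hfin : {e : Total V | e.left = x}.Finite) :
    vtx k x = ∑ e ∈ hfin.toFinset, edg k e * gst k e := by
  rw [vtx, mk_eq_of_rel (.sum_edge_ghost x hne hfin), mk_sum]
  rfl

theorem vtx_mul_edg_of_ne {x : V} {e : Total V} (h : x ≠ e.left) : vtx k x * edg k e = 0 := by
  rw [← vtx_mul_edg, ← mul_assoc, vtx_mul_vtx_of_ne h, zero_mul]

theorem gst_mul_vtx_of_ne {x : V} {e : Total V} (h : e.left ≠ x) : gst k e * vtx k x = 0 := by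
  rw [← gst_mul_vtx, mul_assoc, vtx_mul_vtx_of_ne h, mul_zero]

/-- To prove a property of all elements of `L_k(V)` it suffices to treat the generators and to
check closure under the algebra operations. -/
theorem induction {P : LeavittPathAlgebra k V → Prop} (zero : P 0) (hv : ∀ x, P (vtx k x))
    (he : ∀ e, P (edg k e)) (hg : ∀ e, P (gst k e)) (add : ∀ a b, P a → P b → P (a + b))
    (mul : ∀ a b, P a → P b → P (a * b)) (smul : ∀ (c : k) a, P a → P (c • a))
    (a : LeavittPathAlgebra k V) : P a := by
  obtain ⟨a, rfl⟩ := mk_surjective a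
  have gen : ∀ g : LeavittGen V, P (mk k (MonoidAlgebra.single (FreeSemigroup.of g) 1)) := by
    rintro (x | e | e)
    exacts [hv x, he e, hg e]
  induction a using MonoidAlgebra.induction_linear with
  | zero => exact zero
  | add f g hf hg => exact add _ _ hf hg
  | single m r =>
    have : P (mk k (MonoidAlgebra.single m 1)) := by
      induction m using FreeSemigroup.recOnMul with
      | ih1 g => exact gen g
      | ih2 g m h1 h2 =>
        have := mul _ _ h1 h2
        rwa [← mk_mul, MonoidAlgebra.single_mul_single, one_mul] at this
    have h := smul r _ this
    rwa [← mk_smul, MonoidAlgebra.smul_single, smul_eq_mul, mul_one] at h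

open Classical in
theorem exists_left_unit (a : LeavittPathAlgebra k V) :
    ∃ F : Finset V, (∑ x ∈ F, vtx k x) * a = a := by
  have key : ∃ F : Finset V, ∀ F', F ⊆ F' → (∑ x ∈ F', vtx k x) * a = a := by
    have single : ∀ (x : V) (a : LeavittPathAlgebra k V), vtx k x * a = a →
        ∃ F : Finset V, ∀ F', F ⊆ F' → (∑ x ∈ F', vtx k x) * a = a := by
      refine fun x a h => ⟨{x}, fun F' hF => ?_⟩
      rw [Finset.sum_mul, Finset.sum_eq_single x, h]
      · intro y _ hy
        rw [← h, ← mul_assoc, vtx_mul_vtx_of_ne hy, zero_mul]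
      · exact fun hx => absurd (hF (Finset.mem_singleton_self x)) hx
    induction a using induction with
    | zero => exact ⟨∅, fun _ _ => mul_zero _⟩
    | hv x => exact single x _ (vtx_mul_self x)
    | he e => exact single _ _ (vtx_mul_edg e)
    | hg e => exact single _ _ (vtx_mul_gst e)
    | add a b ha hb =>
      obtain ⟨F, hF⟩ := ha
      obtain ⟨F', hF'⟩ := hb
      refine ⟨F ∪ F', fun T hT => ?_⟩
      rw [mul_add, hF T (Finset.union_subset_left hT), hF' T (Finset.union_subset_right hT)]
    | mul a b ha _ =>
      obtain ⟨F, hF⟩ := ha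
      exact ⟨F, fun T hT => by rw [← mul_assoc, hF T hT]⟩
    | smul _ a ha =>
      obtain ⟨F, hF⟩ := ha
      exact ⟨F, fun T hT => by rw [mul_smul_comm, hF T hT]⟩
  obtain ⟨F, hF⟩ := key
  exact ⟨F, hF F subset_rfl⟩

open Classical in
theorem exists_right_unit (a : LeavittPathAlgebra k V) :
    ∃ F : Finset V, a * (∑ x ∈ F, vtx k x) = a := by
  have key : ∃ F : Finset V, ∀ F', F ⊆ F' → a * (∑ x ∈ F', vtx k x) = a := by
    have single : ∀ (x : V) (a : LeavittPathAlgebra k V), a * vtx k x = a →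
        ∃ F : Finset V, ∀ F', F ⊆ F' → a * (∑ x ∈ F', vtx k x) = a := by
      refine fun x a h => ⟨{x}, fun F' hF => ?_⟩
      rw [Finset.mul_sum, Finset.sum_eq_single x, h]
      · intro y _ hy
        rw [← h, mul_assoc, vtx_mul_vtx_of_ne hy.symm, mul_zero]
      · exact fun hx => absurd (hF (Finset.mem_singleton_self x)) hx
    induction a using induction with
    | zero => exact ⟨∅, fun _ _ => zero_mul _⟩
    | hv x => exact single x _ (vtx_mul_self x)
    | he e => exact single _ _ (edg_mul_vtx e)
    | hg e => exact single _ _ (gst_mul_vtx e)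
    | add a b ha hb =>
      obtain ⟨F, hF⟩ := ha
      obtain ⟨F', hF'⟩ := hb
      refine ⟨F ∪ F', fun T hT => ?_⟩
      rw [add_mul, hF T (Finset.union_subset_left hT), hF' T (Finset.union_subset_right hT)]
    | mul a b _ hb =>
      obtain ⟨F, hF⟩ := hb
      exact ⟨F, fun T hT => by rw [mul_assoc, hF T hT]⟩
    | smul _ a ha =>
      obtain ⟨F, hF⟩ := ha
      exact ⟨F, fun T hT => by rw [smul_mul_assoc, hF T hT]⟩
  obtain ⟨F, hF⟩ := key
  exact ⟨F, hF F subset_rfl⟩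

theorem exists_mul_vtx_ne_zero {a : LeavittPathAlgebra k V} (ha : a ≠ 0) :
    ∃ x, a * vtx k x ≠ 0 := by
  by_contra! h
  obtain ⟨F, hF⟩ := exists_right_unit a
  rw [Finset.mul_sum, Finset.sum_eq_zero fun x _ => h x] at hF
  exact ha hF.symm

end Basic

/-! ### Paths as lists of edges -/

section Lists

variable {V : Type u} [Quiver.{v} V]

/-- The first vertex of the list of edges `l`, to be read as a path ending at `b`. -/
def src : List (Total V) → V → V
  | [], b => b
  | e :: _, _ => e.left

/-- The list of edges `l` is a directed path from `a` to `b`. -/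
def IsPath : V → List (Total V) → V → Prop
  | a, [], b => a = b
  | a, e :: l, b => e.left = a ∧ IsPath e.right l b

theorem IsPath.src_eq {a b : V} {l : List (Total V)} (h : IsPath a l b) : src l b = a := by
  cases l with
  | nil => exact h.symm
  | cons e l => exact h.1

theorem isPath_append {a c : V} {l m : List (Total V)} :
    IsPath a (l ++ m) c ↔ ∃ b, IsPath a l b ∧ IsPath b m c := by
  induction l generalizing a with
  | nil => simp [IsPath]
  | cons e l ih => simp [IsPath, ih, and_assoc]

theorem IsPath.append {a b c : V} {l m : List (Total V)} (h : IsPath a l b) (h' : IsPath b m c) :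
    IsPath a (l ++ m) c :=
  isPath_append.2 ⟨b, h, h'⟩

theorem isPath_singleton (e : Total V) : IsPath e.left [e] e.right := ⟨rfl, rfl⟩

theorem IsPath.exists_path {a b : V} {l : List (Total V)} (h : IsPath a l b) :
    ∃ p : Path a b, p.length = l.length ∧ p.vertices = l.map Total.left ++ [b] := by
  induction l generalizing a with
  | nil =>
    obtain rfl : a = b := h
    exact ⟨Path.nil, rfl, rfl⟩
  | cons e l ih =>
    obtain ⟨rfl, h⟩ := h
    obtain ⟨p, hp, hv⟩ := ih h
    refine ⟨e.hom.toPath.comp p, ?_, ?_⟩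
    · simp [hp, add_comm]
    · rw [Path.vertices_comp, hv]
      simp [Hom.toPath]

theorem exists_isPath {a b : V} (p : Path a b) :
    ∃ l : List (Total V), IsPath a l b ∧ p.length = l.length ∧
      p.vertices = l.map Total.left ++ [b] := by
  induction p with
  | nil => exact ⟨[], rfl, rfl, rfl⟩
  | @cons b c p e ih =>
    obtain ⟨l, hl, hlen, hv⟩ := ih
    refine ⟨l ++ [⟨b, c, e⟩], hl.append (isPath_singleton (⟨b, c, e⟩ : Total V)), ?_, ?_⟩
    · simp [hlen]
    · simp [hv]

theorem nonempty_path_iff {a b : V} : Nonempty (Path a b) ↔ ∃ l, IsPath a l b :=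
  ⟨fun ⟨p⟩ => (exists_isPath p).imp fun _ h => h.1, fun ⟨_, h⟩ => h.exists_path.nonempty⟩

end Lists

/-! ### Paths and ghost paths in the algebra -/

section PathElements

variable (k : Type w) [CommRing k] {V : Type u} [Quiver.{v} V]

/-- The product in `L_k(V)` of the edges in `l`, ending with the vertex `b`. It vanishes unless
`l` is a directed path ending at `b`. -/
noncomputable def pathElt : List (Total V) → V → LeavittPathAlgebra k V
  | [], b => vtx k b
  | e :: l, b => edg k e * pathElt l b

/-- The element `p*` of `L_k(V)`, where `p` is the list of edges `l` ending at `b`. It vanishes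
unless `l` is a directed path ending at `b`. -/
noncomputable def ghostElt : List (Total V) → V → LeavittPathAlgebra k V
  | [], b => vtx k b
  | e :: l, b => ghostElt l b * gst k e

variable {k}

@[simp] theorem pathElt_nil (b : V) : pathElt k [] b = vtx k b := rfl

@[simp] theorem ghostElt_nil (b : V) : ghostElt k [] b = vtx k b := rfl

theorem pathElt_cons (e : Total V) (l : List (Total V)) (b : V) :
    pathElt k (e :: l) b = edg k e * pathElt k l b := rfl

theorem ghostElt_cons (e : Total V) (l : List (Total V)) (b : V) :
    ghostElt k (e :: l) b = ghostElt k l b * gst k e := rfl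

theorem src_mul_pathElt (l : List (Total V)) (b : V) :
    vtx k (src l b) * pathElt k l b = pathElt k l b := by
  cases l with
  | nil => exact vtx_mul_self b
  | cons e l => rw [pathElt_cons, ← mul_assoc, src, vtx_mul_edg]

theorem vtx_mul_pathElt_of_ne {x : V} {l : List (Total V)} {b : V} (h : x ≠ src l b) :
    vtx k x * pathElt k l b = 0 := by
  rw [← src_mul_pathElt, ← mul_assoc, vtx_mul_vtx_of_ne h, zero_mul]

theorem ghostElt_mul_src (l : List (Total V)) (b : V) :
    ghostElt k l b * vtx k (src l b) = ghostElt k l b := by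
  cases l with
  | nil => exact vtx_mul_self b
  | cons e l => rw [ghostElt_cons, mul_assoc, src, gst_mul_vtx]

theorem ghostElt_mul_vtx_of_ne {x : V} {l : List (Total V)} {b : V} (h : src l b ≠ x) :
    ghostElt k l b * vtx k x = 0 := by
  rw [← ghostElt_mul_src, mul_assoc, vtx_mul_vtx_of_ne h, mul_zero]

theorem pathElt_mul_vtx (l : List (Total V)) (b : V) :
    pathElt k l b * vtx k b = pathElt k l b := by
  induction l with
  | nil => exact vtx_mul_self b
  | cons e l ih => rw [pathElt_cons, mul_assoc, ih]

theorem vtx_mul_ghostElt (l : List (Total V)) (b : V) :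
    vtx k b * ghostElt k l b = ghostElt k l b := by
  induction l with
  | nil => exact vtx_mul_self b
  | cons e l ih => rw [ghostElt_cons, ← mul_assoc, ih]

theorem edg_mul_pathElt_of_ne {e : Total V} {l : List (Total V)} {b : V} (h : e.right ≠ src l b) :
    edg k e * pathElt k l b = 0 := by
  rw [← edg_mul_vtx, mul_assoc, vtx_mul_pathElt_of_ne h, mul_zero]

theorem ghostElt_mul_gst_of_ne {e : Total V} {l : List (Total V)} {b : V} (h : src l b ≠ e.right) :
    ghostElt k l b * gst k e = 0 := by
  rw [← vtx_mul_gst, ← mul_assoc, ghostElt_mul_vtx_of_ne h, zero_mul]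

theorem isPath_of_pathElt_ne_zero {l : List (Total V)} {b : V} (h : pathElt k l b ≠ 0) :
    IsPath (src l b) l b := by
  induction l with
  | nil => rfl
  | cons e l ih =>
    have h1 := ih (right_ne_zero_of_mul h)
    have h2 : e.right = src l b := by
      by_contra hne
      exact h (edg_mul_pathElt_of_ne hne)
    exact ⟨rfl, h2 ▸ h1⟩

theorem isPath_of_ghostElt_ne_zero {l : List (Total V)} {b : V} (h : ghostElt k l b ≠ 0) :
    IsPath (src l b) l b := by
  induction l with
  | nil => rfl
  | cons e l ih =>
    have h1 := ih (left_ne_zero_of_mul h)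
    have h2 : e.right = src l b := by
      by_contra hne
      exact h (ghostElt_mul_gst_of_ne (Ne.symm hne))
    exact ⟨rfl, h2 ▸ h1⟩

theorem isPath_of_vtx_mul_pathElt_ne_zero {x b : V} {l : List (Total V)}
    (h : vtx k x * pathElt k l b ≠ 0) : IsPath x l b := by
  have h1 : x = src l b := by
    by_contra hne
    exact h (vtx_mul_pathElt_of_ne hne)
  exact h1 ▸ isPath_of_pathElt_ne_zero (right_ne_zero_of_mul h)

theorem isPath_of_ghostElt_mul_vtx_ne_zero {x b : V} {l : List (Total V)}
    (h : ghostElt k l b * vtx k x ≠ 0) : IsPath x l b := by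
  have h1 : src l b = x := by
    by_contra hne
    exact h (ghostElt_mul_vtx_of_ne hne)
  exact h1 ▸ isPath_of_ghostElt_ne_zero (left_ne_zero_of_mul h)

theorem pathElt_append (l m : List (Total V)) (b : V) :
    pathElt k (l ++ m) b = pathElt k l (src m b) * pathElt k m b := by
  induction l with
  | nil => exact (src_mul_pathElt m b).symm
  | cons e l ih => rw [List.cons_append, pathElt_cons, ih, pathElt_cons, mul_assoc]

theorem ghostElt_append (l m : List (Total V)) (b : V) :
    ghostElt k (l ++ m) b = ghostElt k m b * ghostElt k l (src m b) := by
  induction l with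
  | nil => exact (ghostElt_mul_src m b).symm
  | cons e l ih => rw [List.cons_append, ghostElt_cons, ih, ghostElt_cons, mul_assoc]

theorem IsPath.pathElt_append {a b : V} {m : List (Total V)} (l : List (Total V))
    (h : IsPath a m b) : pathElt k (l ++ m) b = pathElt k l a * pathElt k m b := by
  rw [LeavittPathAlgebra.pathElt_append, h.src_eq]

theorem IsPath.vtx_mul_pathElt {a b : V} {l : List (Total V)} (h : IsPath a l b) :
    vtx k a * pathElt k l b = pathElt k l b := by
  rw [← h.src_eq, src_mul_pathElt]

theorem IsPath.ghostElt_mul_vtx {a b : V} {l : List (Total V)} (h : IsPath a l b) :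
    ghostElt k l b * vtx k a = ghostElt k l b := by
  rw [← h.src_eq, ghostElt_mul_src]

theorem pathElt_singleton (e : Total V) : pathElt k [e] e.right = edg k e := edg_mul_vtx e

theorem pathElt_mul_edg (l : List (Total V)) (e : Total V) :
    pathElt k l e.left * edg k e = pathElt k (l ++ [e]) e.right := by
  rw [pathElt_append, pathElt_singleton, src]

theorem pathElt_mul_edg_of_ne {l : List (Total V)} {b : V} {e : Total V} (h : b ≠ e.left) :
    pathElt k l b * edg k e = 0 := by
  rw [← pathElt_mul_vtx, mul_assoc, vtx_mul_edg_of_ne h, mul_zero]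

/-- The product `p* q` of a ghost path and a path vanishes unless one of `p`, `q` is an initial
segment of the other, and then it is what remains of the longer one. -/
theorem ghostElt_mul_pathElt (l : List (Total V)) (b : V) (m : List (Total V)) (c : V) :
    ghostElt k l b * pathElt k m c = 0 ∨
      (∃ t, m = l ++ t ∧ src t c = b ∧ ghostElt k l b * pathElt k m c = pathElt k t c) ∨
      ∃ t, l = m ++ t ∧ src t b = c ∧ ghostElt k l b * pathElt k m c = ghostElt k t b := by
  induction l generalizing m with
  | nil =>
    by_cases h : b = src m c
    · exact .inr (.inl ⟨m, rfl, h.symm, by rw [ghostElt_nil, h, src_mul_pathElt]⟩)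
    · exact .inl (vtx_mul_pathElt_of_ne h)
  | cons e l ih =>
    cases m with
    | nil =>
      by_cases h : src (e :: l) b = c
      · exact .inr (.inr ⟨e :: l, rfl, h, by rw [pathElt_nil, ← h, ghostElt_mul_src]⟩)
      · exact .inl (ghostElt_mul_vtx_of_ne h)
    | cons f m =>
      rw [ghostElt_cons, pathElt_cons, mul_assoc, ← mul_assoc (gst k e)]
      by_cases hef : e = f
      · subst hef
        rw [gst_mul_edg_self]
        by_cases h : e.right = src m c
        · rw [h, src_mul_pathElt]
          rcases ih m with h | ⟨t, rfl, h⟩ | ⟨t, rfl, h⟩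
          · exact .inl h
          · exact .inr (.inl ⟨t, rfl, h⟩)
          · exact .inr (.inr ⟨t, rfl, h⟩)
        · exact .inl (by rw [vtx_mul_pathElt_of_ne h, mul_zero])
      · exact .inl (by rw [gst_mul_edg_of_ne hef, zero_mul, mul_zero])

theorem IsPath.ghostElt_mul_pathElt_self {a b : V} {l : List (Total V)} (h : IsPath a l b) :
    ghostElt k l b * pathElt k l b = vtx k b := by
  induction l generalizing a with
  | nil => exact vtx_mul_self b
  | cons e l ih =>
    rw [ghostElt_cons, pathElt_cons, mul_assoc, ← mul_assoc (gst k e), gst_mul_edg_self,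
      h.2.vtx_mul_pathElt, ih h.2]

end PathElements

/-! ### Spanning by monomials -/

section Spanning

variable (k : Type w) [CommRing k] {V : Type u} [Quiver.{v} V]

/-- The span of the monomials `p q*` in which the common range of `p` and `q` satisfies `H`. -/
noncomputable def monomialSpan (H : V → Prop) : Submodule k (LeavittPathAlgebra k V) :=
  Submodule.span k {a | ∃ l m b, H b ∧ a = pathElt k l b * ghostElt k m b}

variable {k}

theorem monomial_mem_monomialSpan {H : V → Prop} (l m : List (Total V)) {b : V} (h : H b) :
    pathElt k l b * ghostElt k m b ∈ monomialSpan k H :=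
  Submodule.subset_span ⟨l, m, b, h, rfl⟩

/-- If every edge starting in `H` ends in `H`, then the monomials with range in `H` span a right
ideal. -/
theorem mul_mem_monomialSpan {H : V → Prop} (hH : ∀ e : Total V, H e.left → H e.right)
    {s : LeavittPathAlgebra k V} (hs : s ∈ monomialSpan k H) (a : LeavittPathAlgebra k V) :
    s * a ∈ monomialSpan k H := by
  have of_monomial : ∀ a : LeavittPathAlgebra k V,
      (∀ l m b, H b → pathElt k l b * ghostElt k m b * a ∈ monomialSpan k H) →
      ∀ s ∈ monomialSpan k H, s * a ∈ monomialSpan k H := by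
    intro a ha s hs
    induction hs using Submodule.span_induction with
    | mem x hx =>
      obtain ⟨l, m, b, hb, rfl⟩ := hx
      exact ha l m b hb
    | zero => rw [zero_mul]; exact zero_mem _
    | add x y _ _ hx hy => rw [add_mul]; exact add_mem hx hy
    | smul c x _ hx => rw [smul_mul_assoc]; exact Submodule.smul_mem _ _ hx
  have main : ∀ s ∈ monomialSpan k H, s * a ∈ monomialSpan k H := by
    induction a using induction with
    | zero => intro s _; rw [mul_zero]; exact zero_mem _
    | hv x =>
      refine of_monomial _ fun l m b hb => ?_
      rw [mul_assoc]
      by_cases h : src m b = x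
      · rw [← h, ghostElt_mul_src]
        exact monomial_mem_monomialSpan l m hb
      · rw [ghostElt_mul_vtx_of_ne h, mul_zero]
        exact zero_mem _
    | he e =>
      refine of_monomial _ fun l m b hb => ?_
      rw [mul_assoc, ← pathElt_singleton]
      rcases ghostElt_mul_pathElt (k := k) m b [e] e.right with h | ⟨t, ht, hs, h⟩ | ⟨t, ht, hs, h⟩
      · rw [h, mul_zero]
        exact zero_mem _
      · have hr : H e.right := by
          cases m with
          | nil =>
            obtain rfl : [e] = t := ht
            obtain rfl : e.left = b := hs
            exact hH e hb
          | cons f m =>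
            obtain ⟨-, ht⟩ := List.cons.inj ht
            obtain ⟨-, rfl⟩ := List.append_eq_nil_iff.1 ht.symm
            obtain rfl : e.right = b := hs
            exact hb
        rw [h, ← hs, ← pathElt_append, ← pathElt_mul_vtx]
        exact monomial_mem_monomialSpan (l ++ t) [] hr
      · rw [h]
        exact monomial_mem_monomialSpan l t hb
    | hg e =>
      refine of_monomial _ fun l m b hb => ?_
      rw [mul_assoc]
      exact monomial_mem_monomialSpan l (e :: m) hb
    | add a b ha hb =>
      intro s hs
      rw [mul_add]
      exact add_mem (ha s hs) (hb s hs)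
    | mul a b ha hb =>
      intro s hs
      rw [← mul_assoc]
      exact hb _ (ha s hs)
    | smul c a ha =>
      intro s hs
      rw [mul_smul_comm]
      exact Submodule.smul_mem _ _ (ha s hs)
  exact main s hs

theorem mem_monomialSpan_true (a : LeavittPathAlgebra k V) :
    a ∈ monomialSpan k (fun _ : V => True) := by
  obtain ⟨F, hF⟩ := exists_left_unit a
  rw [← hF]
  refine mul_mem_monomialSpan (fun _ _ => trivial) (sum_mem fun x _ => ?_) a
  have := monomial_mem_monomialSpan (k := k) (H := fun _ : V => True) [] [] (b := x) trivial
  rwa [pathElt_nil, ghostElt_nil, vtx_mul_self] at this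

end Spanning

end LeavittPathAlgebra

namespace LeavittPathAlgebra

/-! ### The universal property -/

section Lift

variable {k : Type w} [CommRing k] {V : Type u} [Quiver.{v} V]
variable {B : Type*} [NonUnitalNonAssocSemiring B] [Module k B]

/-- The universal property of `L_k(V)`: an algebra map on the free algebra respecting the defining
relations descends to `L_k(V)`. -/
noncomputable def lift (φ : FreeLeavitt k V →ₙₐ[k] B)
    (h : ∀ a b, LeavittRel k V a b → φ a = φ b) : LeavittPathAlgebra k V →ₙₐ[k] B where
  toFun := Quotient.lift φ fun a b hab => by
    have hr : RingConGen.Rel _ a b := hab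
    clear hab
    induction hr with
    | of a b hr =>
      obtain ⟨c, a', b', hr, rfl, rfl⟩ := hr
      rw [map_smul, map_smul, h _ _ hr]
    | refl => rfl
    | symm _ ih => exact ih.symm
    | trans _ _ ih ih' => exact ih.trans ih'
    | add _ _ ih ih' => rw [map_add, map_add, ih, ih']
    | mul _ _ ih ih' => rw [map_mul, map_mul, ih, ih']
  map_smul' c a := by
    obtain ⟨a, rfl⟩ := mk_surjective a
    exact map_smul φ c a
  map_zero' := map_zero φ
  map_add' a b := by
    obtain ⟨a, rfl⟩ := mk_surjective a
    obtain ⟨b, rfl⟩ := mk_surjective b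
    exact map_add φ a b
  map_mul' a b := by
    obtain ⟨a, rfl⟩ := mk_surjective a
    obtain ⟨b, rfl⟩ := mk_surjective b
    exact map_mul φ a b

end Lift

/-! ### Branching maps -/

section Branching

variable (V : Type u) [Quiver.{v} V]

/-- An infinite set with at least as many elements as there are edges. -/
abbrev Fibre : Type (max u v) := ℕ ⊕ Total V

/-- As the fibre is infinite and has at least as many elements as there are edges, its product with
any nonempty set of edges is in bijection with it. -/
theorem exists_branching : ∃ act : Total V → Fibre V → Fibre V,
    (∀ e f y z, e.left = f.left → act e y = act f z → e = f ∧ y = z) ∧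
    ∀ (e : Total V) (y : Fibre V), ∃ f z, f.left = e.left ∧ act f z = y := by
  have key : ∀ e : Total V,
      Nonempty ({f : Quiver.Total V // f.left = e.left} × Fibre V ≃ Fibre V) := by
    intro e
    rw [← Cardinal.eq, Cardinal.mk_prod, Cardinal.lift_id, Cardinal.lift_id]
    refine Cardinal.mul_eq_right (Cardinal.aleph0_le_mk _) ?_ ?_
    · exact Cardinal.mk_le_of_injective (f := fun f => Sum.inr f.1)
        (Sum.inr_injective.comp Subtype.val_injective)
    · exact Cardinal.mk_ne_zero_iff.2 ⟨⟨e, rfl⟩⟩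
  have key' : ∀ x : V, ∃ ψ : {f : Quiver.Total V // f.left = x} × Fibre V → Fibre V,
      (∃ e : Quiver.Total V, e.left = x) → Function.Bijective ψ := by
    intro x
    by_cases hx : ∃ e : Quiver.Total V, e.left = x
    · obtain ⟨e, rfl⟩ := hx
      exact ⟨_, fun _ => (key e).some.bijective⟩
    · exact ⟨Prod.snd, fun h => absurd h hx⟩
  choose ψ hψ using key'
  refine ⟨fun e y => ψ e.left (⟨e, rfl⟩, y), fun e f y z hef h => ?_, fun e y => ?_⟩
  · have h2 : ψ f.left (⟨e, hef⟩, y) = ψ f.left (⟨f, rfl⟩, z) := by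
      refine Eq.trans ?_ h
      change _ = ψ e.left (⟨e, rfl⟩, y)
      generalize f.left = x at hef
      subst hef
      rfl
    have := (hψ f.left ⟨f, rfl⟩).1 h2
    simpa using this
  · obtain ⟨⟨⟨f, hf⟩, z⟩, h⟩ := (hψ e.left ⟨e, rfl⟩).2 y
    refine ⟨f, z, hf, ?_⟩
    rw [← h]
    generalize e.left = x at hf
    subst hf
    rfl

variable {V}

/-- A map attached to each edge such that, for every vertex `x` emitting an edge, the maps of
the edges leaving `x` are injective and their images partition the fibre. -/
noncomputable def act : Total V → Fibre V → Fibre V := (exists_branching V).choose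

theorem act_inj {e f : Total V} {y z : Fibre V} (h : e.left = f.left) (h' : act e y = act f z) :
    e = f ∧ y = z :=
  (exists_branching V).choose_spec.1 e f y z h h'

theorem exists_act_eq (e : Total V) (y : Fibre V) : ∃ f z, f.left = e.left ∧ act f z = y :=
  (exists_branching V).choose_spec.2 e y

variable (V) in
/-- The basis of the branching representation: a vertex, a point of its fibre, and a degree. -/
abbrev Branch : Type (max u v) := V × Fibre V × ℤ

end Branching

/-! ### The branching representation -/

section Representation

variable (k : Type w) [CommRing k] {V : Type u} [Quiver.{v} V]

theorem end_ext {X : Type*} {f g : Module.End k (X →₀ k)}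
    (h : ∀ p, f (Finsupp.single p 1) = g (Finsupp.single p 1)) : f = g :=
  Finsupp.lhom_ext' fun p => LinearMap.ext_ring (h p)

open Classical in
/-- A vertex acts on the branching representation as the projection onto its fibre. -/
noncomputable def vertexEnd (x : V) : Module.End k (Branch V →₀ k) :=
  Finsupp.linearCombination k fun p => if p.1 = x then Finsupp.single p 1 else 0

open Classical in
/-- An edge maps the fibre over its range into the fibre over its source, raising the degree. -/
noncomputable def edgeEnd (e : Total V) : Module.End k (Branch V →₀ k) :=
  Finsupp.linearCombination k fun p =>
    if p.1 = e.right then Finsupp.single (e.left, act e p.2.1, p.2.2 + 1) 1 else 0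

open Classical in
/-- A ghost edge acts as the partial inverse of the edge. -/
noncomputable def ghostEnd (e : Total V) : Module.End k (Branch V →₀ k) :=
  Finsupp.linearCombination k fun p =>
    if h : p.1 = e.left ∧ ∃ z, act e z = p.2.1 then
      Finsupp.single (e.right, h.2.choose, p.2.2 - 1) 1 else 0

open Classical in
theorem vertexEnd_single (x : V) (p : Branch V) :
    vertexEnd k x (Finsupp.single p 1) = if p.1 = x then Finsupp.single p 1 else 0 := by
  simp [vertexEnd]

theorem edgeEnd_single (e : Total V) (y : Fibre V) (n : ℤ) :
    edgeEnd k e (Finsupp.single (e.right, y, n) 1) =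
      Finsupp.single (e.left, act e y, n + 1) 1 := by
  simp [edgeEnd]

theorem edgeEnd_single_of_ne {e : Total V} {p : Branch V} (h : p.1 ≠ e.right) :
    edgeEnd k e (Finsupp.single p 1) = 0 := by
  simp [edgeEnd, h]

theorem ghostEnd_single (e : Total V) (y : Fibre V) (n : ℤ) :
    ghostEnd k e (Finsupp.single (e.left, act e y, n) 1) =
      Finsupp.single (e.right, y, n - 1) 1 := by
  have h : ∃ z, act e z = act e y := ⟨y, rfl⟩
  rw [ghostEnd, Finsupp.linearCombination_single, one_smul, dif_pos ⟨rfl, h⟩,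
    (act_inj rfl h.choose_spec).2]

theorem ghostEnd_single_of_ne {e : Total V} {p : Branch V}
    (h : p.1 ≠ e.left ∨ ∀ z, act e z ≠ p.2.1) : ghostEnd k e (Finsupp.single p 1) = 0 := by
  have h' : ¬(p.1 = e.left ∧ ∃ z, act e z = p.2.1) := by
    rintro ⟨h1, z, h2⟩
    exact h.elim (absurd h1) fun h => h z h2
  simp only [ghostEnd, Finsupp.linearCombination_single, dif_neg h', smul_zero]

/-- The free algebra acting on the branching representation. -/
noncomputable def freeRep : FreeLeavitt k V →ₙₐ[k] Module.End k (Branch V →₀ k) :=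
  MonoidAlgebra.liftMagma k (FreeSemigroup.lift fun
    | .vertex x => vertexEnd k x
    | .edge e => edgeEnd k e
    | .ghost e => ghostEnd k e)

theorem freeRep_vertex (x : V) : freeRep k (FreeLeavitt.vertex k x) = vertexEnd k x := by
  simp [freeRep, FreeLeavitt.vertex]

theorem freeRep_edge (e : Total V) : freeRep k (FreeLeavitt.edge k e) = edgeEnd k e := by
  simp [freeRep, FreeLeavitt.edge]

theorem freeRep_ghost (e : Total V) : freeRep k (FreeLeavitt.ghost k e) = ghostEnd k e := by
  simp [freeRep, FreeLeavitt.ghost]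

/-- A basis vector over the source of an edge `e` either comes from a basis vector over the range
of `e`, or is annihilated by `e*`. -/
theorem branch_cases (e : Total V) (p : Branch V) :
    (∃ y n, p = (e.left, act e y, n)) ∨ ghostEnd k e (Finsupp.single p 1) = 0 := by
  obtain ⟨x, y, n⟩ := p
  by_cases h : x = e.left ∧ ∃ z, act e z = y
  · obtain ⟨rfl, z, rfl⟩ := h
    exact .inl ⟨z, n, rfl⟩
  · rw [not_and_or, not_exists] at h
    exact .inr (ghostEnd_single_of_ne k h)

theorem freeRep_eq_of_rel {a b : FreeLeavitt k V} (h : LeavittRel k V a b) :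
    freeRep k a = freeRep k b := by
  classical
  refine end_ext k fun p => ?_
  cases h with
  | vertex_idem x =>
    rw [map_mul, freeRep_vertex, Module.End.mul_apply, vertexEnd_single]
    split_ifs with h
    · rw [vertexEnd_single, if_pos h]
    · rw [map_zero]
  | vertex_orth x y h =>
    rw [map_mul, freeRep_vertex, freeRep_vertex, Module.End.mul_apply, vertexEnd_single, map_zero]
    split_ifs with h'
    · rw [vertexEnd_single, if_neg fun hx => h (hx.symm.trans h')]
      rfl
    · rw [map_zero]
      rfl
  | source_edge e =>
    rw [map_mul, freeRep_vertex, freeRep_edge, Module.End.mul_apply]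
    by_cases h : p.1 = e.right
    · obtain ⟨x, y, n⟩ := p
      obtain rfl : x = e.right := h
      rw [edgeEnd_single, vertexEnd_single, if_pos rfl]
    · rw [edgeEnd_single_of_ne k h, map_zero]
  | edge_range e =>
    rw [map_mul, freeRep_vertex, freeRep_edge, Module.End.mul_apply, vertexEnd_single]
    split_ifs with h
    · rfl
    · rw [edgeEnd_single_of_ne k h, map_zero]
  | range_ghost e =>
    rw [map_mul, freeRep_vertex, freeRep_ghost, Module.End.mul_apply]
    rcases branch_cases k e p with ⟨y, n, rfl⟩ | h
    · rw [ghostEnd_single, vertexEnd_single, if_pos rfl]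
    · rw [h, map_zero]
  | ghost_source e =>
    rw [map_mul, freeRep_vertex, freeRep_ghost, Module.End.mul_apply, vertexEnd_single]
    split_ifs with h
    · rfl
    · rw [ghostEnd_single_of_ne k (.inl h), map_zero]
  | ghost_edge_self e =>
    rw [map_mul, freeRep_vertex, freeRep_ghost, freeRep_edge, Module.End.mul_apply,
      vertexEnd_single]
    split_ifs with h
    · obtain ⟨x, y, n⟩ := p
      obtain rfl : x = e.right := h
      rw [edgeEnd_single, ghostEnd_single, add_sub_cancel_right]
    · rw [edgeEnd_single_of_ne k h, map_zero]
  | ghost_edge_ne e f hef =>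
    rw [map_mul, freeRep_ghost, freeRep_edge, Module.End.mul_apply, map_zero]
    by_cases h : p.1 = f.right
    · obtain ⟨x, y, n⟩ := p
      obtain rfl : x = f.right := h
      rw [edgeEnd_single, ghostEnd_single_of_ne]
      · rfl
      · by_contra! h
        obtain ⟨h1, z, h2⟩ := h
        exact hef (act_inj h1.symm h2).1
    · rw [edgeEnd_single_of_ne k h, map_zero]
      rfl
  | sum_edge_ghost x hne hfin =>
    rw [map_sum, freeRep_vertex, LinearMap.sum_apply, vertexEnd_single]
    simp only [map_mul, freeRep_ghost, freeRep_edge, Module.End.mul_apply]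
    split_ifs with h
    · obtain ⟨e, rfl⟩ := hne
      obtain ⟨x, y, n⟩ := p
      obtain rfl : x = e.left := h
      obtain ⟨f, z, hf, rfl⟩ := exists_act_eq e y
      rw [Finset.sum_eq_single f, ← hf, ghostEnd_single, edgeEnd_single, sub_add_cancel]
      · intro g hg hgf
        rw [ghostEnd_single_of_ne, map_zero]
        refine .inr fun z' hz' => hgf (act_inj ?_ hz').1
        exact (hfin.mem_toFinset.1 hg).trans hf.symm
      · exact fun h => absurd (hfin.mem_toFinset.2 hf) h
    · refine (Finset.sum_eq_zero fun e he => ?_).symm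
      rw [ghostEnd_single_of_ne, map_zero]
      exact .inl fun h' => h (h'.trans (hfin.mem_toFinset.1 he))

/-- The branching representation of `L_k(V)`: every edge `e` maps the fibre over its range
injectively into the fibre over its source, the images of the edges leaving a vertex partition its
fibre, and the degree records how many edges have been applied. -/
noncomputable def rep : LeavittPathAlgebra k V →ₙₐ[k] Module.End k (Branch V →₀ k) :=
  lift (freeRep k) fun _ _ h => freeRep_eq_of_rel k h

theorem rep_vtx (x : V) : rep k (vtx k x) = vertexEnd k x := freeRep_vertex k x

theorem rep_edg (e : Total V) : rep k (edg k e) = edgeEnd k e := freeRep_edge k e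

/-- The composite of the maps attached to the edges of a list. -/
noncomputable def actList : List (Total V) → Fibre V → Fibre V
  | [], y => y
  | e :: l, y => act e (actList l y)

theorem rep_pathElt {a b : V} {l : List (Total V)} (h : IsPath a l b) (y : Fibre V) (n : ℤ) :
    rep k (pathElt k l b) (Finsupp.single (b, y, n) 1) =
      Finsupp.single (a, actList l y, n + l.length) 1 := by
  classical
  induction l generalizing a with
  | nil =>
    obtain rfl : a = b := h
    rw [pathElt_nil, rep_vtx, vertexEnd_single, if_pos rfl]
    simp [actList]
  | cons e l ih =>
    obtain ⟨rfl, h⟩ := h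
    rw [pathElt_cons, map_mul, Module.End.mul_apply, ih h, rep_edg, edgeEnd_single]
    simp [actList, add_assoc]

theorem rep_pathElt_of_ne {p : Branch V} {b : V} (h : p.1 ≠ b) (l : List (Total V)) :
    rep k (pathElt k l b) (Finsupp.single p 1) = 0 := by
  classical
  rw [← pathElt_mul_vtx, map_mul, Module.End.mul_apply, rep_vtx, vertexEnd_single, if_neg h,
    map_zero]

theorem pathElt_ne_zero [Nontrivial k] {a b : V} {l : List (Total V)} (h : IsPath a l b) :
    pathElt k l b ≠ 0 := by
  intro h0
  have := rep_pathElt k h (Sum.inl 0) 0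
  rw [h0, map_zero, LinearMap.zero_apply] at this
  exact one_ne_zero (Finsupp.single_eq_zero.1 this.symm)

theorem vtx_ne_zero [Nontrivial k] (x : V) : vtx k x ≠ 0 := pathElt_ne_zero (l := []) k rfl

theorem actList_inj {a b : V} {l m : List (Total V)} (hl : IsPath a l b) (hm : IsPath a m b)
    (hlen : l.length = m.length) {y : Fibre V} (h : actList l y = actList m y) : l = m := by
  induction l generalizing a m with
  | nil => exact (List.eq_nil_of_length_eq_zero hlen.symm).symm
  | cons e l ih =>
    cases m with
    | nil => cases hlen
    | cons f m =>
      obtain ⟨rfl, hl⟩ := hl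
      obtain ⟨hfe, hm⟩ := hm
      obtain ⟨rfl, h'⟩ := act_inj hfe.symm h
      rw [ih hl hm (Nat.succ.inj hlen) h']

/-- The lists of edges that form a path ending at `b`. -/
abbrev PathsTo (b : V) : Type (max u v) := {l : List (Total V) // IsPath (src l b) l b}

/-- Distinct paths ending at `b` send a basis vector over `b` to distinct basis vectors; paths of
different lengths are told apart by the degree. -/
theorem pathsTo_injective (b : V) (y : Fibre V) (n : ℤ) : Function.Injective
    fun l : PathsTo b => ((src l.1 b, actList l.1 y, n + l.1.length) : Branch V) := by
  rintro ⟨l, hl⟩ ⟨m, hm⟩ h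
  simp only [Prod.mk.injEq, add_right_inj, Nat.cast_inj] at h
  exact Subtype.ext (actList_inj hl (h.1 ▸ hm) h.2.2 h.2.1)

theorem rep_linearCombination (b : V) (y : Fibre V) (n : ℤ) (c : PathsTo b →₀ k) :
    rep k (Finsupp.linearCombination k (fun l : PathsTo b => pathElt k l.1 b) c)
      (Finsupp.single (b, y, n) 1) =
    c.mapDomain fun l : PathsTo b => ((src l.1 b, actList l.1 y, n + l.1.length) : Branch V) := by
  rw [Finsupp.linearCombination_apply, Finsupp.sum, map_sum, LinearMap.sum_apply,
    Finsupp.mapDomain, Finsupp.sum]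
  refine Finset.sum_congr rfl fun l _ => ?_
  rw [map_smul, LinearMap.smul_apply, rep_pathElt k l.2, Finsupp.smul_single, smul_eq_mul, mul_one]

end Representation

end LeavittPathAlgebra

/-! ### Faithful irreducible representations -/

section SimpleModules

variable {A : Type*} [NonUnitalRing A] {M : Type*} [AddCommGroup M] {ρ : A →ₙ+* AddMonoid.End M}

theorem endHom_mul_apply (a b : A) (x : M) : ρ (a * b) x = ρ a (ρ b x) := by
  rw [map_mul]
  rfl

theorem endHom_add_apply (a b : A) (x : M) : ρ (a + b) x = ρ a x + ρ b x := by
  rw [map_add]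
  rfl

theorem endHom_sub_apply (a b : A) (x : M) : ρ (a - b) x = ρ a x - ρ b x := by
  rw [map_sub]
  rfl

/-- A nonzero vector of an irreducible representation generates it. -/
theorem exists_apply_eq_of_irreducible (hne : ∃ (a : A) (m : M), ρ a m ≠ 0)
    (hirr : ∀ N : AddSubgroup M, (∀ (a : A), ∀ m ∈ N, ρ a m ∈ N) → N = ⊥ ∨ N = ⊤)
    {x : M} (hx : x ≠ 0) (m : M) : ∃ a, ρ a x = m := by
  let N : AddSubgroup M :=
    { carrier := {m | ∃ a, ρ a x = m}
      zero_mem' := ⟨0, by rw [map_zero]; rfl⟩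
      add_mem' := by
        rintro _ _ ⟨a, rfl⟩ ⟨b, rfl⟩
        exact ⟨a + b, by rw [map_add]; rfl⟩
      neg_mem' := by
        rintro _ ⟨a, rfl⟩
        exact ⟨-a, by rw [map_neg]; rfl⟩ }
  have hN : ∀ (a : A), ∀ m ∈ N, ρ a m ∈ N := by
    rintro a _ ⟨b, rfl⟩
    exact ⟨a * b, by rw [map_mul]; rfl⟩
  rcases hirr N hN with h | h
  · exfalso
    -- The vectors annihilated by the whole ring form a proper submodule, hence vanish.
    let T : AddSubgroup M :=
      { carrier := {m | ∀ a, ρ a m = 0}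
        zero_mem' := fun a => map_zero _
        add_mem' := fun {m n} hm hn a => by rw [map_add, hm a, hn a, add_zero]
        neg_mem' := fun {m} hm a => by rw [map_neg, hm a, neg_zero] }
    have hT : ∀ (a : A), ∀ m ∈ T, ρ a m ∈ T := by
      intro a m hm b
      rw [hm a, map_zero]
    have hxT : x ∈ T := fun a => by
      have : ρ a x ∈ N := ⟨a, rfl⟩
      rwa [h, AddSubgroup.mem_bot] at this
    rcases hirr T hT with h' | h'
    · rw [h', AddSubgroup.mem_bot] at hxT
      exact hx hxT
    · obtain ⟨a, m, ham⟩ := hne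
      have : m ∈ T := h' ▸ AddSubgroup.mem_top m
      exact ham (this a)
  · exact (h ▸ AddSubgroup.mem_top m : m ∈ N)

theorem exists_apply_ne_zero_of_faithful (hinj : Function.Injective ρ) {a : A} (ha : a ≠ 0) :
    ∃ m, ρ a m ≠ 0 := by
  by_contra! h
  exact ha (hinj (by rw [map_zero]; exact AddMonoidHom.ext h))

/-- In a faithful irreducible representation, the ideal generated by a nonzero element `u` moves
any nonzero vector to any other vector. -/
theorem exists_mul_mul_apply_eq (hinj : Function.Injective ρ)
    (hne : ∃ (a : A) (m : M), ρ a m ≠ 0)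
    (hirr : ∀ N : AddSubgroup M, (∀ (a : A), ∀ m ∈ N, ρ a m ∈ N) → N = ⊥ ∨ N = ⊤)
    {u : A} (hu : u ≠ 0) {x : M} (hx : x ≠ 0) (m : M) : ∃ a b, ρ (a * u * b) x = m := by
  obtain ⟨n, hn⟩ := exists_apply_ne_zero_of_faithful hinj hu
  obtain ⟨b, hb⟩ := exists_apply_eq_of_irreducible hne hirr hx n
  obtain ⟨a, ha⟩ := exists_apply_eq_of_irreducible hne hirr hn m
  refine ⟨a, b, ?_⟩
  rw [endHom_mul_apply, endHom_mul_apply, hb, ha]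

end SimpleModules

namespace LeavittPathAlgebra

/-! ### Primitivity implies downward directedness -/

section DownwardDirected

variable {k : Type w} [CommRing k] {V : Type u} [Quiver.{v} V]

theorem exists_isPath_of_vtx_mul_mul_vtx_ne_zero {x y : V} {a : LeavittPathAlgebra k V}
    (h : vtx k x * a * vtx k y ≠ 0) : ∃ z l m, IsPath x l z ∧ IsPath y m z := by
  by_contra! hxy
  refine h ?_
  have ha := mem_monomialSpan_true a
  clear h
  induction ha using Submodule.span_induction with
  | mem a ha =>
    obtain ⟨l, m, b, -, rfl⟩ := ha
    by_contra h
    rw [← mul_assoc, mul_assoc] at h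
    exact hxy b l m (isPath_of_vtx_mul_pathElt_ne_zero (left_ne_zero_of_mul h))
      (isPath_of_ghostElt_mul_vtx_ne_zero (right_ne_zero_of_mul h))
  | zero => rw [mul_zero, zero_mul]
  | add a b _ _ ha hb => rw [mul_add, add_mul, ha, hb, add_zero]
  | smul c a _ ha => rw [mul_smul_comm, smul_mul_assoc, ha, smul_zero]

theorem isDownwardDirectedGraph_of_isPrimitiveRing [Nontrivial k]
    (h : IsPrimitiveRing (LeavittPathAlgebra k V)) : IsDownwardDirectedGraph V := by
  obtain ⟨M, _, ρ, hinj, hne, hirr⟩ := h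
  intro x y
  obtain ⟨m, hm⟩ := exists_apply_ne_zero_of_faithful hinj (vtx_ne_zero k x)
  obtain ⟨n, hn⟩ := exists_apply_ne_zero_of_faithful hinj (vtx_ne_zero k y)
  obtain ⟨a, ha⟩ := exists_apply_eq_of_irreducible hne hirr hn m
  have h : vtx k x * a * vtx k y ≠ 0 := by
    intro h0
    have : ρ (vtx k x * a * vtx k y) n = 0 := by rw [h0, map_zero]; rfl
    rw [endHom_mul_apply, endHom_mul_apply, ha] at this
    exact hm this
  obtain ⟨z, l, p, hl, hp⟩ := exists_isPath_of_vtx_mul_mul_vtx_ne_zero h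
  exact ⟨z, nonempty_path_iff.2 ⟨l, hl⟩, nonempty_path_iff.2 ⟨p, hp⟩⟩

end DownwardDirected

/-! ### Primitivity implies countable separation -/

section CountableSeparation

variable {k : Type w} [CommRing k] {V : Type u} [Quiver.{v} V]

/-- The ideal generated by a vertex `x` is contained in the span of the monomials `p q*` whose
range can be reached from `x`. -/
theorem mul_vtx_mul_mem_monomialSpan (a b : LeavittPathAlgebra k V) (x : V) :
    a * vtx k x * b ∈ monomialSpan k fun z => ∃ l, IsPath x l z := by
  refine mul_mem_monomialSpan (fun e ⟨l, hl⟩ => ⟨l ++ [e], hl.append (isPath_singleton e)⟩) ?_ b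
  have ha := mem_monomialSpan_true a
  induction ha using Submodule.span_induction with
  | mem a ha =>
    obtain ⟨l, m, b, -, rfl⟩ := ha
    rw [mul_assoc]
    by_cases h : ghostElt k m b * vtx k x = 0
    · rw [h, mul_zero]
      exact zero_mem _
    · have hm := isPath_of_ghostElt_mul_vtx_ne_zero h
      rw [hm.ghostElt_mul_vtx]
      exact monomial_mem_monomialSpan l m ⟨m, hm⟩
  | zero => rw [zero_mul]; exact zero_mem _
  | add a b _ _ ha hb => rw [add_mul]; exact add_mem ha hb
  | smul c a _ ha => rw [smul_mul_assoc]; exact Submodule.smul_mem _ _ ha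

variable {M : Type*} [AddCommGroup M] (ρ : LeavittPathAlgebra k V →ₙ+* AddMonoid.End M)

/-- Only finitely many ghost paths `p*` satisfy `p* y x ≠ 0` without `p` passing through `H`
before its end: such a `p` is an initial segment of a path occurring in `y`. -/
theorem finite_ghostElt_mul_apply_ne_zero {H : V → Prop} {y : LeavittPathAlgebra k V}
    (hy : y ∈ monomialSpan k H) (x : M) :
    {p : List (Total V) × V | ρ (ghostElt k p.1 p.2 * y) x ≠ 0 ∧
      ∀ l t, p.1 = l ++ t → t ≠ [] → ¬H (src t p.2)}.Finite := by
  induction hy using Submodule.span_induction with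
  | mem y hy =>
    obtain ⟨l, m, b, hb, rfl⟩ := hy
    refine ((Set.finite_Iic l.length).image
      fun i => (l.take i, src (l.drop i) b)).subset ?_
    rintro ⟨q, c⟩ ⟨hne, hq⟩
    have initial : ∀ t, l = q ++ t → src t b = c →
        (q, c) ∈ (fun i => (l.take i, src (l.drop i) b)) '' Set.Iic l.length := by
      rintro t rfl rfl
      exact ⟨q.length, by simp, by simp⟩
    rw [← mul_assoc, map_mul] at hne
    rcases ghostElt_mul_pathElt (k := k) q c l b with h | ⟨t, ht, hs, -⟩ | ⟨t, ht, hs, -⟩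
    · refine absurd ?_ hne
      rw [h, map_zero, zero_mul]
      rfl
    · exact initial t ht hs
    · by_cases h : t = []
      · subst h
        exact initial [] (by simpa using ht.symm) hs.symm
      · exact absurd (hs ▸ hb : H (src t c)) (hq l t ht h)
  | zero =>
    refine Set.finite_empty.subset ?_
    rintro p ⟨h, -⟩
    rw [mul_zero, map_zero] at h
    exact h rfl
  | add y z _ _ hy hz =>
    refine (hy.union hz).subset ?_
    rintro p ⟨h, hp⟩
    rw [mul_add, endHom_add_apply] at h
    by_cases h1 : ρ (ghostElt k p.1 p.2 * y) x = 0
    · refine .inr ⟨fun h2 => h ?_, hp⟩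
      rw [h1, h2, add_zero]
    · exact .inl ⟨h1, hp⟩
  | smul c y _ hy =>
    refine hy.subset ?_
    rintro p ⟨h, hp⟩
    refine ⟨fun h0 => h ?_, hp⟩
    -- `M` is only a module over the algebra, so the scalar is absorbed into a vertex.
    rw [mul_smul_comm, ← vtx_mul_ghostElt, mul_assoc, ← smul_mul_assoc, endHom_mul_apply, h0,
      map_zero]

/-- If `x` is a nonzero vector of a faithful simple module, each vertex `u` satisfies `a u b x = x`
for some `a`, `b`. Hence the ranges of the paths `p` with `p* x ≠ 0` separate the graph. If they
are uncountable, let `n` be the first length at which infinitely many such paths occur: then the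
ranges of the shorter ones already separate. -/
theorem countableSeparationProperty_of_isPrimitiveRing [Nonempty V] [Nontrivial k]
    (h : IsPrimitiveRing (LeavittPathAlgebra k V)) : CountableSeparationProperty V := by
  obtain ⟨M, _, ρ, hinj, hne, hirr⟩ := h
  obtain ⟨x, hx⟩ : ∃ x : M, x ≠ 0 := by
    obtain ⟨a, m, h⟩ := hne
    exact ⟨_, h⟩
  let P : ℕ → Set (List (Total V) × V) := fun n =>
    {p | p.1.length = n ∧ ρ (ghostElt k p.1 p.2) x ≠ 0}
  have hy : ∀ u : V, ∃ y ∈ monomialSpan k (fun z => ∃ l, IsPath u l z), ρ y x = x := by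
    intro u
    obtain ⟨a, b, h⟩ := exists_mul_mul_apply_eq hinj hne hirr (vtx_ne_zero k u) hx x
    exact ⟨_, mul_vtx_mul_mem_monomialSpan a b u, h⟩
  by_contra hcsp
  have hfin : ∀ n, (P n).Finite := by
    intro n
    induction n using Nat.strong_induction_on with
    | _ n ih =>
    have hcount : (⋃ j ∈ Set.Iio n, Prod.snd '' P j).Countable :=
      (Set.to_countable _).biUnion fun j hj => ((ih j hj).image _).countable
    obtain ⟨u, hu⟩ : ∃ u, ∀ z ∈ ⋃ j ∈ Set.Iio n, Prod.snd '' P j, ¬Nonempty (Path u z) := by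
      by_contra! h
      exact hcsp ⟨_, hcount, h⟩
    obtain ⟨y, hy, hyx⟩ := hy u
    refine (finite_ghostElt_mul_apply_ne_zero ρ hy x).subset ?_
    rintro ⟨q, c⟩ ⟨rfl, hq⟩
    refine ⟨?_, ?_⟩
    · rw [endHom_mul_apply, hyx]
      exact hq
    · rintro l t rfl ht hr
      refine hu (src t c) ?_ (nonempty_path_iff.2 hr)
      refine Set.mem_biUnion (x := l.length) ?_ ⟨(l, src t c), ⟨rfl, fun h0 => hq ?_⟩, rfl⟩
      · have := List.length_pos_of_ne_nil ht
        simpa using this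
      · rw [ghostElt_append, endHom_mul_apply, h0, map_zero]
  refine hcsp ⟨⋃ n, Prod.snd '' P n,
    Set.countable_iUnion fun n => ((hfin n).image _).countable, fun u => ?_⟩
  by_contra! hu
  obtain ⟨y, hy, hyx⟩ := hy u
  have key : ρ y x = 0 := by
    clear hyx
    induction hy using Submodule.span_induction with
    | mem y hy =>
      obtain ⟨l, m, b, hb, rfl⟩ := hy
      have hm : ρ (ghostElt k m b) x = 0 := by
        by_contra h
        exact not_nonempty_iff.2 (hu b (Set.mem_iUnion.2 ⟨m.length, (m, b), ⟨rfl, h⟩, rfl⟩))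
          (nonempty_path_iff.2 hb)
      rw [endHom_mul_apply, hm, map_zero]
    | zero => rw [map_zero]; rfl
    | add y z _ _ hy hz => rw [endHom_add_apply, hy, hz, add_zero]
    | smul c y _ hy =>
      obtain ⟨F, hF⟩ := exists_left_unit y
      rw [← hF, ← smul_mul_assoc, endHom_mul_apply, hy, map_zero]
  exact hx (hyx.symm.trans key)

end CountableSeparation

/-! ### Primitivity implies condition (L) -/

section NoExit

variable {k : Type w} [CommRing k] {V : Type u} [Quiver.{v} V]

/-- `S` is a set of vertices each of which emits exactly one edge, and that edge ends in `S`. -/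
structure IsNoExitSet (S : V → Prop) : Prop where
  right_mem : ∀ e : Total V, S e.left → S e.right
  unique : ∀ e f : Total V, S e.left → f.left = e.left → f = e
  exists_edge : ∀ x, S x → ∃ e : Total V, e.left = x

variable {S : V → Prop}

theorem IsNoExitSet.end_mem (hS : IsNoExitSet S) {a b : V} {l : List (Total V)}
    (hl : IsPath a l b) (ha : S a) : S b := by
  induction l generalizing a with
  | nil =>
    obtain rfl : a = b := hl
    exact ha
  | cons e l ih =>
    obtain ⟨rfl, hl⟩ := hl
    exact ih hl (hS.right_mem e ha)

theorem IsNoExitSet.edg_mul_gst (hS : IsNoExitSet S) {e : Total V} (he : S e.left) :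
    edg k e * gst k e = vtx k e.left := by
  have h : {f : Total V | f.left = e.left} = {e} :=
    Set.ext fun f => ⟨fun hf => hS.unique e f he hf, fun hf => by rw [hf]; rfl⟩
  have hfin : {f : Total V | f.left = e.left}.Finite := h ▸ Set.finite_singleton e
  rw [vtx_eq_sum e.left ⟨e, rfl⟩ hfin, Finset.sum_eq_single e]
  · exact fun f hf hfe => absurd (hS.unique e f he (hfin.mem_toFinset.1 hf)) hfe
  · exact fun h => absurd (hfin.mem_toFinset.2 rfl) h

theorem IsNoExitSet.pathElt_mul_ghostElt (hS : IsNoExitSet S) {a b : V} {l : List (Total V)}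
    (hl : IsPath a l b) (ha : S a) : pathElt k l b * ghostElt k l b = vtx k a := by
  induction l generalizing a with
  | nil =>
    obtain rfl : a = b := hl
    exact vtx_mul_self a
  | cons e l ih =>
    obtain ⟨rfl, hl⟩ := hl
    rw [pathElt_cons, ghostElt_cons, mul_assoc, ← mul_assoc (pathElt k l b),
      ih hl (hS.right_mem e ha), vtx_mul_gst, hS.edg_mul_gst ha]

theorem IsNoExitSet.path_unique (hS : IsNoExitSet S) {a b c : V} {l m : List (Total V)}
    (hl : IsPath a l b) (hm : IsPath a m c) (ha : S a) (h : l.length = m.length) :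
    l = m ∧ b = c := by
  induction l generalizing a m with
  | nil =>
    obtain rfl := List.eq_nil_of_length_eq_zero h.symm
    exact ⟨rfl, hl.symm.trans hm⟩
  | cons e l ih =>
    cases m with
    | nil => cases h
    | cons f m =>
      obtain ⟨rfl, hl⟩ := hl
      obtain rfl := hS.unique e f ha hm.1
      obtain ⟨rfl, rfl⟩ := ih hl hm.2 (hS.right_mem _ ha) (Nat.succ.inj h)
      exact ⟨rfl, rfl⟩

theorem IsNoExitSet.exists_path_of_length (hS : IsNoExitSet S) {a : V} (ha : S a) (n : ℕ) :
    ∃ l b, IsPath a l b ∧ l.length = n := by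
  induction n generalizing a with
  | zero => exact ⟨[], a, rfl, rfl⟩
  | succ n ih =>
    obtain ⟨e, rfl⟩ := hS.exists_edge a ha
    obtain ⟨l, b, hl, hn⟩ := ih (hS.right_mem e ha)
    exact ⟨e :: l, b, ⟨rfl, hl⟩, by rw [List.length_cons, hn]⟩

/-- Extending both factors of `p q*` by the same path does not change the product. -/
theorem IsNoExitSet.monomial_extend (hS : IsNoExitSet S) {b c : V} {t : List (Total V)}
    (ht : IsPath b t c) (hb : S b) (l m : List (Total V)) :
    pathElt k (l ++ t) c * ghostElt k (m ++ t) c = pathElt k l b * ghostElt k m b := by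
  rw [ht.pathElt_append, ghostElt_append, ht.src_eq, mul_assoc, ← mul_assoc (pathElt k t c),
    hS.pathElt_mul_ghostElt ht hb, vtx_mul_ghostElt]

/-- Up to extension, `(p q*)(p' q'*) = r s*` with `|r| = |p| + |p'|` and `|s| = |q| + |q'|`. -/
theorem IsNoExitSet.exists_monomial_mul (hS : IsNoExitSet S) {a b b' : V}
    {l m l' m' : List (Total V)} (ha : S a) (hl : IsPath a l b) (hm : IsPath a m b)
    (hl' : IsPath a l' b') (hm' : IsPath a m' b') :
    ∃ r s c, IsPath a r c ∧ IsPath a s c ∧ r.length = l.length + l'.length ∧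
      s.length = m.length + m'.length ∧
      pathElt k l b * ghostElt k m b * (pathElt k l' b' * ghostElt k m' b') =
        pathElt k r c * ghostElt k s c := by
  have hb := hS.end_mem hl ha
  have hb' := hS.end_mem hl' ha
  obtain ⟨t, c, ht, htl⟩ := hS.exists_path_of_length hb l'.length
  obtain ⟨t', c', ht', htl'⟩ := hS.exists_path_of_length hb' m.length
  obtain ⟨h, rfl⟩ := hS.path_unique (hm.append ht) (hl'.append ht') ha
    (by simp only [List.length_append]; omega)
  refine ⟨l ++ t, m' ++ t', c, hl.append ht, hm'.append ht', by simp [htl],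
    by simp [htl', add_comm], ?_⟩
  rw [← hS.monomial_extend ht hb, ← hS.monomial_extend ht' hb', h, mul_assoc,
    ← mul_assoc (ghostElt k (l' ++ t') c), (hl'.append ht').ghostElt_mul_pathElt_self,
    vtx_mul_ghostElt]

/-- The corner of `L_k(V)` at a vertex all of whose paths are forced is commutative. -/
theorem IsNoExitSet.corner_comm (hS : IsNoExitSet S) {x : V} (hx : S x)
    (a b : LeavittPathAlgebra k V) :
    vtx k x * a * vtx k x * (vtx k x * b * vtx k x) =
      vtx k x * b * vtx k x * (vtx k x * a * vtx k x) := by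
  have ha := mem_monomialSpan_true a
  have hb := mem_monomialSpan_true b
  have cases_monomial : ∀ (l m : List (Total V)) (c : V),
      vtx k x * (pathElt k l c * ghostElt k m c) * vtx k x = 0 ∨ IsPath x l c ∧ IsPath x m c ∧
      vtx k x * (pathElt k l c * ghostElt k m c) * vtx k x = pathElt k l c * ghostElt k m c := by
    intro l m c
    by_cases h : vtx k x * (pathElt k l c * ghostElt k m c) * vtx k x = 0
    · exact .inl h
    · rw [← mul_assoc, mul_assoc] at h
      have h1 := isPath_of_vtx_mul_pathElt_ne_zero (left_ne_zero_of_mul h)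
      have h2 := isPath_of_ghostElt_mul_vtx_ne_zero (right_ne_zero_of_mul h)
      refine .inr ⟨h1, h2, ?_⟩
      rw [← mul_assoc, mul_assoc, h1.vtx_mul_pathElt, h2.ghostElt_mul_vtx]
  induction ha using Submodule.span_induction with
  | mem a ha =>
    obtain ⟨l, m, c, -, rfl⟩ := ha
    induction hb using Submodule.span_induction with
    | mem b hb =>
      obtain ⟨l', m', c', -, rfl⟩ := hb
      rcases cases_monomial l m c with h | ⟨hl, hm, h⟩
      · rw [h, zero_mul, mul_zero]
      rcases cases_monomial l' m' c' with h' | ⟨hl', hm', h'⟩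
      · rw [h', zero_mul, mul_zero]
      rw [h, h']
      obtain ⟨r, s, d, hr, hs, hrl, hsl, heq⟩ :=
        hS.exists_monomial_mul (k := k) hx hl hm hl' hm'
      obtain ⟨r', s', d', hr', hs', hrl', hsl', heq'⟩ :=
        hS.exists_monomial_mul (k := k) hx hl' hm' hl hm
      obtain ⟨rfl, rfl⟩ := hS.path_unique hr hr' hx (by omega)
      obtain ⟨rfl, -⟩ := hS.path_unique hs hs' hx (by omega)
      rw [heq, heq']
    | zero => simp only [mul_zero, zero_mul]
    | add b b' _ _ hb hb' => simp only [mul_add, add_mul] at hb hb' ⊢; rw [hb, hb']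
    | smul c b _ hb => simp only [mul_smul_comm, smul_mul_assoc] at hb ⊢; rw [hb]
  | zero => simp only [mul_zero, zero_mul]
  | add a a' _ _ ha ha' => simp only [mul_add, add_mul] at ha ha' ⊢; rw [ha, ha']
  | smul c a _ ha => simp only [mul_smul_comm, smul_mul_assoc] at ha ⊢; rw [ha]

theorem IsPath.right_mem {a b : V} {l : List (Total V)} (hl : IsPath a l b) {e : Total V}
    (he : e ∈ l) : e.right ∈ l.map Total.left ++ [b] := by
  induction l generalizing a with
  | nil => cases he
  | cons f l ih =>
    rcases List.mem_cons.1 he with rfl | he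
    · cases l with
      | nil => simp [show e.right = b from hl.2]
      | cons g l => simp [hl.2.1]
    · exact List.mem_cons_of_mem _ (ih hl.2 he)

theorem isNoExitSet_of_not_hasExit {a : V} {p : Path a a} (hp : 0 < p.length)
    (h : ¬HasExit p) : IsNoExitSet fun x => x ∈ p.vertices := by
  obtain ⟨l, hl, hlen, hv⟩ := exists_isPath p
  have hex : ∀ x ∈ p.vertices, ∃ e ∈ l, e.left = x := by
    intro x hx
    rw [hv, List.mem_append, List.mem_singleton] at hx
    rcases hx with hx | rfl
    · simpa using hx
    · cases l with
      | nil => simp [hlen] at hp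
      | cons e l => exact ⟨e, List.mem_cons_self, hl.1⟩
  have huniq : ∀ e f : Total V, e.left ∈ p.vertices → f.left = e.left → f = e := by
    intro e f he hf
    by_contra hne
    exact h ⟨e.left, he, f, e, hf, rfl, hne⟩
  refine ⟨fun e he => ?_, huniq, fun x hx => (hex x hx).imp fun _ h => h.2⟩
  obtain ⟨f, hf, hfe⟩ := hex _ he
  obtain rfl := huniq e f he hfe
  rw [hv]
  exact hl.right_mem hf

/-- The difference of a vertex and a nontrivial closed path at it has no right inverse in the corner
at the vertex: on the branching representation both act alike up to the sum of coefficients. -/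
theorem vtx_sub_pathElt_mul_ne_vtx [Nontrivial k] {a : V} {l : List (Total V)}
    (hl : IsPath a l a) (b : LeavittPathAlgebra k V) : (vtx k a - pathElt k l a) * b ≠ vtx k a := by
  classical
  let ε : (Branch V →₀ k) →ₗ[k] k := Finsupp.linearCombination k fun _ => 1
  have hε : ε ∘ₗ rep k (vtx k a) = ε ∘ₗ rep k (pathElt k l a) := by
    refine Finsupp.lhom_ext' fun p => LinearMap.ext_ring ?_
    simp only [LinearMap.comp_apply, Finsupp.lsingle_apply]
    by_cases h : p.1 = a
    · obtain ⟨x, y, n⟩ := p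
      obtain rfl : x = a := h
      rw [rep_pathElt k hl, rep_vtx, vertexEnd_single, if_pos rfl]
      simp [ε]
    · rw [rep_pathElt_of_ne k h, rep_vtx, vertexEnd_single, if_neg h]
  intro h
  let ξ : Branch V →₀ k := Finsupp.single (a, Sum.inl 0, 0) 1
  have h1 : ε (rep k (vtx k a) ξ) = 1 := by
    rw [rep_vtx, vertexEnd_single, if_pos rfl]
    simp [ε]
  have h2 : ε (rep k ((vtx k a - pathElt k l a) * b) ξ) = 0 := by
    rw [map_mul, map_sub, Module.End.mul_apply, LinearMap.sub_apply, map_sub, sub_eq_zero]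
    exact LinearMap.congr_fun hε _
  rw [h, h1] at h2
  exact one_ne_zero h2

theorem vtx_sub_pathElt_ne_zero [Nontrivial k] {a : V} {l : List (Total V)}
    (hl : IsPath a l a) (hne : l ≠ []) : vtx k a - pathElt k l a ≠ 0 := by
  intro h
  have := rep_pathElt k hl (Sum.inl 0) 0
  rw [← sub_eq_zero.1 h, ← pathElt_nil, rep_pathElt k (l := []) rfl, Finsupp.single_left_inj
    one_ne_zero] at this
  have hpos := List.length_pos_of_ne_nil hne
  simp at this
  omega

theorem conditionL_of_isPrimitiveRing [Nontrivial k]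
    (h : IsPrimitiveRing (LeavittPathAlgebra k V)) : ConditionL V := by
  obtain ⟨M, _, ρ, hinj, hne, hirr⟩ := h
  intro a p hp
  by_contra hexit
  have hS := isNoExitSet_of_not_hasExit hp.1 hexit
  have ha : a ∈ p.vertices := Path.start_mem_vertices p
  obtain ⟨l, hl, hlen, -⟩ := exists_isPath p
  have hlne : l ≠ [] := by
    rintro rfl
    exact hp.1.ne' hlen
  set v := vtx k a with hv
  have hvv : v * v = v := vtx_mul_self a
  set d := v - pathElt k l a with hd
  have hvd : v * d = d := by rw [hd, mul_sub, hvv, hl.vtx_mul_pathElt]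
  have hdv : d * v = d := by rw [hd, sub_mul, hvv, pathElt_mul_vtx]
  have hd0 : d ≠ 0 := vtx_sub_pathElt_ne_zero hl hlne
  obtain ⟨m, hm⟩ := exists_apply_ne_zero_of_faithful hinj hd0
  obtain ⟨b, hb⟩ := exists_apply_eq_of_irreducible hne hirr hm (ρ v m)
  have comm : ∀ x y, v * x * v * (v * y * v) = v * y * v * (v * x * v) :=
    fun x y => hS.corner_comm ha x y
  have hvne : ρ v m ≠ 0 := by
    intro h0
    apply hm
    rw [← hdv, endHom_mul_apply, h0, map_zero]
  -- `z` lies in the corner at `a` and annihilates the vector `v m`, which generates the module.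
  set z := v * b * v * d - v with hz
  have hzv : z * v = z := by
    rw [hz, sub_mul, hvv, mul_assoc _ d v, hdv]
  have hvz : v * z = z := by
    rw [hz, mul_sub, hvv]
    simp only [← mul_assoc, hvv]
  have hzm : ρ z (ρ v m) = 0 := by
    have h : z = v * (b * d) - v := by rw [hz, mul_assoc (v * b) v d, hvd, mul_assoc]
    rw [← endHom_mul_apply, hzv, h, endHom_sub_apply, endHom_mul_apply, endHom_mul_apply, hb,
      ← endHom_mul_apply, hvv, sub_self]
  have hz0 : z = 0 := by
    by_contra hne0
    obtain ⟨n, hn⟩ := exists_apply_ne_zero_of_faithful hinj hne0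
    obtain ⟨c, hc⟩ := exists_apply_eq_of_irreducible hne hirr hvne n
    have h1 : z * (v * c * v) = v * c * v * z := by
      have h := comm z c
      rwa [hvz, hzv] at h
    have h2 : ρ z n = ρ (z * (v * c * v)) (ρ v m) := by
      rw [← hc, ← endHom_mul_apply, ← endHom_mul_apply, ← endHom_mul_apply,
        mul_assoc z (v * c * v) v, mul_assoc (v * c) v v, hvv, mul_assoc v c v,
        ← mul_assoc z v, hzv, mul_assoc]
    exact hn (by rw [h2, h1, endHom_mul_apply, hzm, map_zero])
  refine vtx_sub_pathElt_mul_ne_vtx (k := k) hl (v * b * v) ?_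
  have h := comm d b
  rw [hvd, hdv] at h
  exact h.trans (sub_eq_zero.1 hz0)

end NoExit

end LeavittPathAlgebra

namespace LeavittPathAlgebra

/-! ### Moving elements into the span of the paths -/

section PathSpan

variable (k : Type w) [CommRing k] (V : Type u) [Quiver.{v} V]

/-- The span of the paths in `L_k(V)`, that is, the image of the path algebra. -/
noncomputable def pathSpan : Submodule k (LeavittPathAlgebra k V) :=
  Submodule.span k {a | ∃ l b, a = pathElt k l b}

/-- The span of the monomials `p q*` with `|q| ≤ n`. -/
noncomputable def ghostFiltration (n : ℕ) : Submodule k (LeavittPathAlgebra k V) :=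
  Submodule.span k {a | ∃ l m b, m.length ≤ n ∧ a = pathElt k l b * ghostElt k m b}

variable {k V}

theorem pathElt_mem_pathSpan (l : List (Total V)) (b : V) : pathElt k l b ∈ pathSpan k V :=
  Submodule.subset_span ⟨l, b, rfl⟩

theorem mul_vtx_mem_pathSpan {p : LeavittPathAlgebra k V} (hp : p ∈ pathSpan k V) (x : V) :
    p * vtx k x ∈ pathSpan k V := by
  induction hp using Submodule.span_induction with
  | mem p hp =>
    obtain ⟨l, b, rfl⟩ := hp
    by_cases h : b = x
    · rw [← h, pathElt_mul_vtx]
      exact pathElt_mem_pathSpan l b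
    · rw [← pathElt_mul_vtx, mul_assoc, vtx_mul_vtx_of_ne h, mul_zero]
      exact zero_mem _
  | zero => rw [zero_mul]; exact zero_mem _
  | add p q _ _ hp hq => rw [add_mul]; exact add_mem hp hq
  | smul c p _ hp => rw [smul_mul_assoc]; exact Submodule.smul_mem _ _ hp

theorem exists_linearCombination {p : LeavittPathAlgebra k V} (hp : p ∈ pathSpan k V) (x : V) :
    ∃ c : PathsTo x →₀ k,
      Finsupp.linearCombination k (fun l : PathsTo x => pathElt k l.1 x) c = p * vtx k x := by
  change _ ∈ LinearMap.range _
  induction hp using Submodule.span_induction with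
  | mem p hp =>
    obtain ⟨l, b, rfl⟩ := hp
    by_cases h : pathElt k l b * vtx k x = 0
    · rw [h]
      exact zero_mem _
    · have hb : b = x := by
        by_contra hne
        exact h (by rw [← pathElt_mul_vtx, mul_assoc, vtx_mul_vtx_of_ne hne, mul_zero])
      subst hb
      rw [pathElt_mul_vtx] at h ⊢
      exact ⟨Finsupp.single ⟨l, isPath_of_pathElt_ne_zero h⟩ 1, by simp⟩
  | zero => rw [zero_mul]; exact zero_mem _
  | add p q _ _ hp hq => rw [add_mul]; exact add_mem hp hq
  | smul c p _ hp => rw [smul_mul_assoc]; exact Submodule.smul_mem _ _ hp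

/-- Right multiplication by an edge is injective on the combinations of paths ending at its
source: the paths composed with the edge send a basis vector of the branching representation to
distinct basis vectors. -/
theorem mul_vtx_eq_zero_of_mul_edg_eq_zero {p : LeavittPathAlgebra k V} (hp : p ∈ pathSpan k V)
    {e : Total V} (h : p * edg k e = 0) : p * vtx k e.left = 0 := by
  obtain ⟨c, hc⟩ := exists_linearCombination hp e.left
  have h1 : p * vtx k e.left * edg k e = 0 := by rw [mul_assoc, vtx_mul_edg, h]
  rw [← hc] at h1 ⊢
  have h2 := congrArg (fun a => rep k a (Finsupp.single (e.right, Sum.inl 0, 0) 1)) h1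
  simp only [map_mul, Module.End.mul_apply, rep_edg, edgeEnd_single, map_zero,
    LinearMap.zero_apply, rep_linearCombination] at h2
  have h3 : c = 0 := Finsupp.mapDomain_injective (pathsTo_injective e.left _ _)
    (h2.trans Finsupp.mapDomain_zero.symm)
  rw [h3, map_zero]

open Classical in
theorem gst_mul_sum_edg_mul_gst {e : Total V} {F : Finset (Total V)} (he : e ∈ F) :
    gst k e * ∑ f ∈ F, edg k f * gst k f = gst k e := by
  rw [Finset.mul_sum, Finset.sum_eq_single e, ← mul_assoc, gst_mul_edg_self, vtx_mul_gst]
  · intro f _ hf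
    rw [← mul_assoc, gst_mul_edg_of_ne hf.symm, zero_mul]
  · exact fun h => absurd he h

open Classical in
/-- Modulo combinations of paths, every element lies in a finite sum of the left ideals
`L_k(V) e e*`. -/
theorem exists_sub_mul_sum_eq (a : LeavittPathAlgebra k V) :
    ∃ p ∈ pathSpan k V, ∃ F : Finset (Total V),
      (a - p) * ∑ e ∈ F, edg k e * gst k e = a - p := by
  suffices ∃ p ∈ pathSpan k V, ∃ F : Finset (Total V), ∀ F', F ⊆ F' →
      (a - p) * ∑ e ∈ F', edg k e * gst k e = a - p by
    obtain ⟨p, hp, F, h⟩ := this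
    exact ⟨p, hp, F, h F subset_rfl⟩
  have ha := mem_monomialSpan_true a
  induction ha using Submodule.span_induction with
  | mem a ha =>
    obtain ⟨l, m, b, -, rfl⟩ := ha
    cases m with
    | nil =>
      refine ⟨_, pathElt_mem_pathSpan l b, ∅, fun F' _ => ?_⟩
      rw [ghostElt_nil, pathElt_mul_vtx, sub_self, zero_mul]
    | cons e m =>
      refine ⟨0, zero_mem _, {e}, fun F' hF => ?_⟩
      rw [sub_zero, ghostElt_cons, mul_assoc, mul_assoc,
        gst_mul_sum_edg_mul_gst (hF (Finset.mem_singleton_self e))]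
  | zero => exact ⟨0, zero_mem _, ∅, fun F' _ => by rw [sub_zero, zero_mul]⟩
  | add a b _ _ ha hb =>
    obtain ⟨p, hp, F, hF⟩ := ha
    obtain ⟨q, hq, F', hF'⟩ := hb
    refine ⟨p + q, add_mem hp hq, F ∪ F', fun T hT => ?_⟩
    rw [add_sub_add_comm, add_mul, hF T (Finset.union_subset_left hT),
      hF' T (Finset.union_subset_right hT)]
  | smul c a _ ha =>
    obtain ⟨p, hp, F, hF⟩ := ha
    exact ⟨c • p, Submodule.smul_mem _ _ hp, F, fun T hT => by
      rw [← smul_sub, smul_mul_assoc, hF T hT]⟩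

/-- An element annihilated by right multiplication by all edges lies in the span of the paths, up to
right multiplication by a vertex `x`. If `x` is a sink, all ghost edges are killed by `x`. If `x`
emits finitely many edges, then `a x = 0` by the relation `x = ∑ e e*`. If `x` emits infinitely
many, multiplying by one that does not occur in `a` shows that the path part of `a x` vanishes, and
then so does `a x`. -/
theorem mul_vtx_mem_pathSpan_of_forall_mul_edg {a : LeavittPathAlgebra k V}
    (ha : ∀ e, a * edg k e = 0) (x : V) : a * vtx k x ∈ pathSpan k V := by
  by_cases hfin : {e : Total V | e.left = x}.Finite
  · by_cases hne : {e : Total V | e.left = x}.Nonempty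
    · rw [vtx_eq_sum x hne hfin, Finset.mul_sum, Finset.sum_eq_zero]
      · exact zero_mem _
      · intro e _
        rw [← mul_assoc, ha, zero_mul]
    · obtain ⟨p, hp, F, hF⟩ := exists_sub_mul_sum_eq a
      have h : (a - p) * vtx k x = 0 := by
        rw [← hF, mul_assoc, Finset.sum_mul, Finset.sum_eq_zero, mul_zero]
        intro e _
        rw [mul_assoc, gst_mul_vtx_of_ne fun h => hne ⟨e, h⟩, mul_zero]
      rw [sub_mul, sub_eq_zero] at h
      exact h ▸ mul_vtx_mem_pathSpan hp x
  · obtain ⟨p, hp, F, hF⟩ := exists_sub_mul_sum_eq a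
    obtain ⟨f, rfl, hfF⟩ := Set.Infinite.exists_notMem_finset hfin F
    have hpf : p * edg k f = 0 := by
      have h : (a - p) * edg k f = 0 := by
        rw [← hF, mul_assoc, Finset.sum_mul, Finset.sum_eq_zero, mul_zero]
        intro e he
        have hef : e ≠ f := fun h => hfF (h ▸ he)
        rw [mul_assoc, gst_mul_edg_of_ne hef, mul_zero]
      rwa [sub_mul, ha, zero_sub, neg_eq_zero] at h
    have hpx := mul_vtx_eq_zero_of_mul_edg_eq_zero hp hpf
    have h : (a - p) * vtx k f.left = 0 := by
      rw [← hF, mul_assoc, Finset.sum_mul, Finset.mul_sum]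
      refine Finset.sum_eq_zero fun e _ => ?_
      rw [mul_assoc, ← mul_assoc, sub_mul, ha, zero_sub]
      by_cases he : e.left = f.left
      · rw [← vtx_mul_edg e, ← mul_assoc p, he, hpx, zero_mul, neg_zero, zero_mul]
      · rw [gst_mul_vtx_of_ne he, mul_zero]
    rw [sub_mul, hpx, sub_zero] at h
    rw [h]
    exact zero_mem _

theorem mul_edg_mem_ghostFiltration {n : ℕ} {a : LeavittPathAlgebra k V}
    (ha : a ∈ ghostFiltration k V (n + 1)) (e : Total V) :
    a * edg k e ∈ ghostFiltration k V n := by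
  induction ha using Submodule.span_induction with
  | mem a ha =>
    obtain ⟨l, m, b, hm, rfl⟩ := ha
    cases m with
    | nil =>
      rw [ghostElt_nil, pathElt_mul_vtx]
      by_cases h : b = e.left
      · rw [h, pathElt_mul_edg, ← pathElt_mul_vtx]
        exact Submodule.subset_span ⟨_, [], _, Nat.zero_le _, rfl⟩
      · rw [pathElt_mul_edg_of_ne h]
        exact zero_mem _
    | cons f m =>
      rw [ghostElt_cons, mul_assoc, mul_assoc]
      by_cases h : f = e
      · subst h
        rw [gst_mul_edg_self]
        by_cases hs : src m b = f.right
        · rw [← hs, ghostElt_mul_src]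
          exact Submodule.subset_span ⟨l, m, b, Nat.le_of_succ_le_succ hm, rfl⟩
        · rw [ghostElt_mul_vtx_of_ne hs, mul_zero]
          exact zero_mem _
      · rw [gst_mul_edg_of_ne h, mul_zero, mul_zero]
        exact zero_mem _
  | zero => rw [zero_mul]; exact zero_mem _
  | add p q _ _ hp hq => rw [add_mul]; exact add_mem hp hq
  | smul c p _ hp => rw [smul_mul_assoc]; exact Submodule.smul_mem _ _ hp

theorem ghostFiltration_mono : Monotone (ghostFiltration k V) := by
  intro m n hmn
  refine Submodule.span_mono ?_
  rintro a ⟨l, q, b, hq, rfl⟩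
  exact ⟨l, q, b, hq.trans hmn, rfl⟩

theorem exists_mem_ghostFiltration (a : LeavittPathAlgebra k V) :
    ∃ n, a ∈ ghostFiltration k V n := by
  have ha := mem_monomialSpan_true a
  induction ha using Submodule.span_induction with
  | mem a ha =>
    obtain ⟨l, m, b, -, rfl⟩ := ha
    exact ⟨m.length, Submodule.subset_span ⟨l, m, b, le_rfl, rfl⟩⟩
  | zero => exact ⟨0, zero_mem _⟩
  | add a b _ _ ha hb =>
    obtain ⟨m, hm⟩ := ha
    obtain ⟨n, hn⟩ := hb
    exact ⟨max m n, add_mem (ghostFiltration_mono (le_max_left m n) hm)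
      (ghostFiltration_mono (le_max_right m n) hn)⟩
  | smul c a _ ha =>
    obtain ⟨n, hn⟩ := ha
    exact ⟨n, Submodule.smul_mem _ _ hn⟩

/-- Every nonzero element has a nonzero right multiple in the span of the paths: multiplying by an
edge shortens the ghost paths, and if all edges annihilate the element, a vertex will do. -/
theorem exists_mul_mem_pathSpan {a : LeavittPathAlgebra k V} (ha : a ≠ 0) :
    ∃ d, a * d ≠ 0 ∧ a * d ∈ pathSpan k V := by
  obtain ⟨n, hn⟩ := exists_mem_ghostFiltration a
  replace hn := ghostFiltration_mono n.le_succ hn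
  have main : ∀ n, ∀ a ∈ ghostFiltration k V n, a ≠ 0 → ∃ d, a * d ≠ 0 ∧ a * d ∈ pathSpan k V := by
    intro n
    induction n with
    | zero =>
      intro a hn ha
      obtain ⟨x, hx⟩ := exists_mul_vtx_ne_zero ha
      refine ⟨vtx k x, hx, mul_vtx_mem_pathSpan (Submodule.span_mono ?_ hn) x⟩
      rintro a ⟨l, m, b, hm, rfl⟩
      obtain rfl := List.eq_nil_of_length_eq_zero (Nat.le_zero.1 hm)
      exact ⟨l, b, by rw [ghostElt_nil, pathElt_mul_vtx]⟩
    | succ n ih =>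
      intro a hn ha
      by_cases h : ∀ e, a * edg k e = 0
      · obtain ⟨x, hx⟩ := exists_mul_vtx_ne_zero ha
        exact ⟨vtx k x, hx, mul_vtx_mem_pathSpan_of_forall_mul_edg h x⟩
      · push Not at h
        obtain ⟨e, he⟩ := h
        obtain ⟨d, hd⟩ := ih _ (mul_edg_mem_ghostFiltration hn e) he
        exact ⟨edg k e * d, by rwa [← mul_assoc]⟩
  exact main _ a hn ha

end PathSpan

/-! ### Aperiodic paths under condition (L) -/

section ConditionL

variable {V : Type u} [Quiver.{v} V]

/-- A closed path of minimal positive length visits no vertex twice. -/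
theorem nodup_of_minimal {x : V} {l : List (Total V)} (hl : IsPath x l x)
    (hmin : ∀ m, IsPath x m x → m ≠ [] → l.length ≤ m.length) : (l.map Total.left).Nodup := by
  rw [List.Nodup, List.pairwise_iff_getElem]
  intro i j hi hj hij heq
  rw [List.length_map] at hi hj
  rw [List.getElem_map, List.getElem_map] at heq
  have split : ∀ (i : ℕ) (hi : i < l.length),
      IsPath x (l.take i) l[i].left ∧ IsPath l[i].left (l.drop i) x := by
    intro i hi
    obtain ⟨b, h1, h2⟩ := isPath_append.1 ((List.take_append_drop i l).symm ▸ hl)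
    have hb : l[i].left = b := by
      rw [List.drop_eq_getElem_cons hi] at h2
      exact h2.1
    exact hb ▸ ⟨h1, h2⟩
  have h := hmin (l.take i ++ l.drop j) ((split i hi).1.append (heq ▸ (split j hj).2)) (by
    simp [hj])
  simp only [List.length_append, List.length_take, List.length_drop] at h
  omega

/-- Under condition (L), a vertex on a closed path lies on a cycle with an exit. -/
theorem exists_cycle_with_exit (hL : ConditionL V) {x : V}
    (hx : ∃ l : List (Total V), IsPath x l x ∧ l ≠ []) :
    ∃ (l m : List (Total V)) (e : Total V), IsPath x l x ∧ l ≠ [] ∧ IsPath x m e.left ∧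
      (∀ f ∈ m, f ∈ l) ∧ e ∉ l := by
  classical
  have hx' : ∃ n, ∃ l : List (Total V), IsPath x l x ∧ l ≠ [] ∧ l.length = n :=
    let ⟨l, h1, h2⟩ := hx
    ⟨_, l, h1, h2, rfl⟩
  obtain ⟨l, hl, hne, hlen⟩ := Nat.find_spec hx'
  have hnodup := nodup_of_minimal hl fun m hm hm' =>
    hlen.trans_le (Nat.find_min' hx' ⟨m, hm, hm', rfl⟩)
  obtain ⟨p, hp, hv⟩ := hl.exists_path
  obtain ⟨y, hy, e, f, he, hf, hef⟩ := hL x p ⟨by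
    rw [hp]
    exact List.length_pos_of_ne_nil hne, by rwa [hv, List.dropLast_concat]⟩
  obtain ⟨g, hg, rfl⟩ : ∃ g ∈ l, g.left = y := by
    rw [hv, List.mem_append, List.mem_singleton] at hy
    rcases hy with hy | rfl
    · simpa using hy
    · cases l with
      | nil => exact absurd rfl hne
      | cons e l => exact ⟨e, List.mem_cons_self, hl.1⟩
  obtain ⟨e', he', hne'⟩ : ∃ e' : Total V, e'.left = g.left ∧ e' ≠ g := by
    by_cases h : e = g
    · exact ⟨f, hf, fun h' => hef (h.trans h'.symm)⟩
    · exact ⟨e, he, h⟩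
  obtain ⟨m, m', rfl⟩ := List.append_of_mem hg
  obtain ⟨b, hm, hb, -⟩ := isPath_append.1 hl
  refine ⟨_, m, e', hl, hne, ?_, fun f hf => List.mem_append_left _ hf, fun h => hne' ?_⟩
  · rw [he', hb]
    exact hm
  · exact List.inj_on_of_nodup_map hnodup h hg he'

variable (k : Type w) [CommRing k]

/-- Under condition (L), from every vertex `x` there is a path `q` with `q* p q = 0` for all
nonempty paths `p` of length at most `n`. If `x` lies on a closed path, then `q` winds around a
cycle long enough and leaves it along an exit `e`: if `q` were an initial segment of `p q`, the
last edge `e` of `q` would be among the earlier edges of `q`. -/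
theorem exists_aperiodic_path (hL : ConditionL V) (x : V) (n : ℕ) :
    ∃ (q : List (Total V)) (z : V), IsPath x q z ∧ ∀ t, t ≠ [] → t.length ≤ n →
      ghostElt k q z * pathElt k (t ++ q) z = 0 := by
  by_cases hx : ∃ l : List (Total V), IsPath x l x ∧ l ≠ []
  · obtain ⟨l, m, e, hl, hne, hm, hml, he⟩ := exists_cycle_with_exit hL hx
    have wind : ∀ n : ℕ, ∃ r, IsPath x r x ∧ n ≤ r.length ∧ ∀ f ∈ r, f ∈ l := by
      intro n
      induction n with
      | zero => exact ⟨[], rfl, le_rfl, fun f hf => absurd hf List.not_mem_nil⟩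
      | succ n ih =>
        obtain ⟨r, hr, hn, hrl⟩ := ih
        have := List.length_pos_of_ne_nil hne
        refine ⟨r ++ l, hr.append hl, by rw [List.length_append]; omega, fun f hf => ?_⟩
        exact (List.mem_append.1 hf).elim (hrl f) id
    obtain ⟨r, hr, hn, hrl⟩ := wind n
    have hs : ∀ f ∈ r ++ m, f ∈ l := fun f hf => (List.mem_append.1 hf).elim (hrl f) (hml f)
    have hlen : n ≤ (r ++ m).length := by rw [List.length_append]; omega
    refine ⟨(r ++ m) ++ [e], e.right, (hr.append hm).append (isPath_singleton e), ?_⟩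
    intro t ht htn
    have htpos := List.length_pos_of_ne_nil ht
    generalize r ++ m = s at hs hlen
    rcases ghostElt_mul_pathElt (k := k) (s ++ [e]) e.right (t ++ (s ++ [e])) e.right with
      h | ⟨u, hu, -⟩ | ⟨u, hu, -⟩
    · exact h
    · exfalso
      have h := congrArg (fun L => L[s.length]?) hu
      simp only [List.append_assoc] at h
      rw [List.getElem?_append_right (by omega), List.getElem?_append_left (by omega),
        List.getElem?_append_right le_rfl, Nat.sub_self, List.singleton_append,
        List.getElem?_cons_zero] at h
      exact he (hs e (List.mem_of_getElem? h))
    · have h := congrArg List.length hu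
      simp only [List.length_append] at h
      omega
  · refine ⟨[], x, rfl, fun t ht _ => ?_⟩
    rw [List.append_nil, ghostElt_nil]
    by_contra h
    exact hx ⟨t, isPath_of_vtx_mul_pathElt_ne_zero h, ht⟩

end ConditionL

/-! ### Nonzero ideals contain vertices -/

section Reduction

variable {k : Type w} [Field k] {V : Type u} [Quiver.{v} V]

/-- Under condition (L), every nonzero ideal of `L_k(V)` contains a vertex. A nonzero element is
first multiplied into the span of the paths. If `p` is a path of minimal length in the result
`a`, then `p* a` has a nonzero multiple of a vertex as its constant term, and an aperiodic path
kills the remaining terms. -/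
theorem exists_mul_mul_eq_vtx (hL : ConditionL V) {a : LeavittPathAlgebra k V} (ha : a ≠ 0) :
    ∃ b d x, b * a * d = vtx k x := by
  obtain ⟨d, hd, hdp⟩ := exists_mul_mem_pathSpan ha
  obtain ⟨x, hx⟩ := exists_mul_vtx_ne_zero hd
  obtain ⟨c, hc⟩ := exists_linearCombination hdp x
  have hc0 : c.support.Nonempty := by
    rw [Finsupp.support_nonempty_iff]
    rintro rfl
    exact hx (by rw [← hc, map_zero])
  obtain ⟨p, hp, hmin⟩ := c.support.exists_min_image (fun l => l.1.length) hc0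
  obtain ⟨q, z, hq, hqt⟩ :=
    exists_aperiodic_path k hL x (c.support.sup fun l => l.1.length)
  have key : ghostElt k q z * ghostElt k p.1 x * (a * d * vtx k x) * pathElt k q z =
      c p • vtx k z := by
    rw [← hc, Finsupp.linearCombination_apply, Finsupp.sum, Finset.mul_sum, Finset.sum_mul,
      Finset.sum_eq_single p]
    · rw [mul_smul_comm, smul_mul_assoc, mul_assoc (ghostElt k q z),
        p.2.ghostElt_mul_pathElt_self, mul_assoc, hq.vtx_mul_pathElt,
        hq.ghostElt_mul_pathElt_self]
    · intro l hl hlp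
      rw [mul_smul_comm, smul_mul_assoc, mul_assoc (ghostElt k q z)]
      rcases ghostElt_mul_pathElt (k := k) p.1 x l.1 x with h | ⟨t, ht, -, h⟩ | ⟨t, ht, -⟩
      · rw [h, mul_zero, zero_mul, smul_zero]
      · rw [h, mul_assoc, ← hq.pathElt_append, hqt t, smul_zero]
        · rintro rfl
          exact hlp (Subtype.ext (by rw [ht, List.append_nil]))
        · have h1 := Finset.le_sup (f := fun l : PathsTo x => l.1.length) hl
          rw [ht, List.length_append] at h1
          omega
      · have h1 := hmin l hl
        have h2 := congrArg List.length ht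
        rw [List.length_append] at h2
        obtain rfl := List.eq_nil_of_length_eq_zero (l := t) (by omega)
        exact absurd (Subtype.ext (by rw [ht, List.append_nil])) hlp
    · exact fun h => absurd hp h
  refine ⟨(c p)⁻¹ • (ghostElt k q z * ghostElt k p.1 x), d * vtx k x * pathElt k q z, z, ?_⟩
  have hcp : c p ≠ 0 := Finsupp.mem_support_iff.1 hp
  rw [← inv_smul_smul₀ hcp (vtx k z), ← key]
  simp only [smul_mul_assoc, mul_assoc]

end Reduction

end LeavittPathAlgebra

/-! ### A criterion for primitivity -/

section Criterion

/-- A ring is primitive if it has a proper left ideal `I`, modular with right unit `e`, such that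
every nonzero two-sided ideal contains `e` modulo `I`: then the annihilator of the quotient by a
maximal left ideal containing `I` vanishes. -/
theorem isPrimitiveRing_of_leftIdeal {A : Type u} [NonUnitalRing A] (e : A) (I : AddSubgroup A)
    (hI : ∀ a, ∀ b ∈ I, a * b ∈ I) (heI : e ∉ I) (hmod : ∀ a, a - a * e ∈ I)
    (hcomax : ∀ a, a ≠ 0 → ∃ b d, e - b * a * d ∈ I) : IsPrimitiveRing A := by
  obtain ⟨N, hIN, hN⟩ : ∃ N, I ≤ N ∧
      Maximal (· ∈ {N : AddSubgroup A | (∀ a, ∀ b ∈ N, a * b ∈ N) ∧ e ∉ N}) N := by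
    refine zorn_le_nonempty₀ _ (fun C hC hchain J hJ => ?_) I ⟨hI, heI⟩
    have hmem : ∀ {x}, x ∈ sSup C ↔ ∃ K ∈ C, x ∈ K :=
      AddSubgroup.mem_sSup_of_directedOn ⟨J, hJ⟩ hchain.directedOn
    refine ⟨sSup C, ⟨fun a b hb => ?_, fun he => ?_⟩, fun K hK => le_sSup hK⟩
    · obtain ⟨K, hK, hb⟩ := hmem.1 hb
      exact hmem.2 ⟨K, hK, (hC hK).1 a b hb⟩
    · obtain ⟨K, hK, he⟩ := hmem.1 he
      exact (hC hK).2 he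
  obtain ⟨hNl, heN⟩ := hN.prop
  let ρ : A →ₙ+* AddMonoid.End (A ⧸ N) :=
    { toFun := fun a => QuotientAddGroup.map N N (AddMonoidHom.mulLeft a) fun b hb => hNl a b hb
      map_mul' := fun a b => by
        refine AddMonoidHom.ext fun x => ?_
        induction x using QuotientAddGroup.induction_on with
        | H x => exact congrArg _ (mul_assoc a b x)
      map_zero' := by
        refine AddMonoidHom.ext fun x => ?_
        induction x using QuotientAddGroup.induction_on with
        | H x => exact congrArg _ (zero_mul x)
      map_add' := fun a b => by
        refine AddMonoidHom.ext fun x => ?_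
        induction x using QuotientAddGroup.induction_on with
        | H x => exact congrArg _ (add_mul a b x) }
  have hρ : ∀ a x : A, ρ a (x : A ⧸ N) = ((a * x : A) : A ⧸ N) := fun _ _ => rfl
  refine ⟨A ⧸ N, inferInstance, ρ, ?_, ⟨e, (e : A ⧸ N), ?_⟩, fun K hK => ?_⟩
  · rw [injective_iff_map_eq_zero]
    intro a ha
    by_contra hne
    obtain ⟨b, d, h⟩ := hcomax a hne
    have h0 : ρ (b * a * d) (e : A ⧸ N) = 0 := by
      rw [map_mul, map_mul, ha, mul_zero, zero_mul]
      rfl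
    rw [hρ, QuotientAddGroup.eq_zero_iff] at h0
    refine heN ?_
    have := add_mem (add_mem (hIN h) (hIN (hmod (b * a * d)))) h0
    rwa [sub_add_sub_cancel, sub_add_cancel] at this
  · rw [hρ, Ne, QuotientAddGroup.eq_zero_iff]
    intro h
    refine heN ?_
    have := add_mem (hIN (hmod e)) h
    rwa [sub_add_cancel] at this
  · by_cases he : (e : A ⧸ N) ∈ K
    · right
      refine (AddSubgroup.eq_top_iff' K).2 fun x => ?_
      induction x using QuotientAddGroup.induction_on with
      | H x =>
        have : (x : A ⧸ N) = ρ x (e : A ⧸ N) :=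
          (QuotientAddGroup.eq_iff_sub_mem).2 (hIN (hmod x))
        rw [this]
        exact hK x _ he
    · left
      refine (AddSubgroup.eq_bot_iff_forall K).2 fun x hx => ?_
      induction x using QuotientAddGroup.induction_on with
      | H x =>
        have hle := hN.le_of_ge (y := K.comap (QuotientAddGroup.mk' N))
          ⟨fun a b hb => hK a _ hb, he⟩ (fun y hy => by
            change (y : A ⧸ N) ∈ K
            rw [(QuotientAddGroup.eq_zero_iff y).2 hy]
            exact zero_mem K)
        exact (QuotientAddGroup.eq_zero_iff x).2 (hle hx)

end Criterion

/-! ### Primitivity from the graph -/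

namespace LeavittPathAlgebra

variable {k : Type w} {V : Type u} [Quiver.{v} V]

/-- In a downward directed graph with the countable separation property, some sequence of paths
`p₀, p₁, …`, each extending the preceding one, has the property that every vertex reaches the
range of some `pₙ`. -/
theorem exists_cofinal_paths [Nonempty V] (hdd : IsDownwardDirectedGraph V)
    (hcsp : CountableSeparationProperty V) :
    ∃ (x₀ : V) (p : ℕ → List (Total V)) (r : ℕ → V), (∀ n, IsPath x₀ (p n) (r n)) ∧
      (∀ n, ∃ q, p (n + 1) = p n ++ q ∧ IsPath (r n) q (r (n + 1))) ∧
      ∀ y, ∃ n l, IsPath y l (r n) := by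
  obtain ⟨X, hX, hsep⟩ := hcsp
  have hXne : X.Nonempty := by
    obtain ⟨x, hx, -⟩ := hsep (Classical.arbitrary V)
    exact ⟨x, hx⟩
  obtain ⟨f, rfl⟩ := hX.exists_eq_range hXne
  have step : ∀ (n : ℕ) (x : V), ∃ (q : List (Total V)) (z : V), IsPath x q z ∧
      ∃ l, IsPath (f n) l z := by
    intro n x
    obtain ⟨z, h1, h2⟩ := hdd x (f n)
    obtain ⟨q, hq⟩ := nonempty_path_iff.1 h1
    exact ⟨q, z, hq, nonempty_path_iff.1 h2⟩
  choose q z hq hf using step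
  let s : ℕ → List (Total V) × V := fun n =>
    Nat.rec ([], f 0) (fun n s => (s.1 ++ q n s.2, z n s.2)) n
  refine ⟨f 0, fun n => (s n).1, fun n => (s n).2, fun n => ?_, fun n => ?_, fun y => ?_⟩
  · induction n with
    | zero => rfl
    | succ n ih => exact ih.append (hq n (s n).2)
  · exact ⟨q n (s n).2, rfl, hq n (s n).2⟩
  · obtain ⟨_, ⟨n, rfl⟩, hy⟩ := hsep y
    obtain ⟨l, hl⟩ := nonempty_path_iff.1 hy
    obtain ⟨m, hm⟩ := hf n (s n).2
    exact ⟨n + 1, l ++ m, hl.append hm⟩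

/-- The left ideal of the elements annihilated by right multiplication by some path of a cofinal
sequence is comaximal with every nonzero two-sided ideal: such an ideal contains a vertex, hence the
range of some `pₙ`, hence `pₙ pₙ*`, while `(x₀ - pₙ pₙ*) pₙ = 0`. -/
theorem isPrimitiveRing_of_graph [Field k] [Nonempty V] (hL : ConditionL V)
    (hdd : IsDownwardDirectedGraph V) (hcsp : CountableSeparationProperty V) :
    IsPrimitiveRing (LeavittPathAlgebra k V) := by
  obtain ⟨x₀, p, r, hp, hext, hcof⟩ := exists_cofinal_paths hdd hcsp
  have mono : ∀ a : LeavittPathAlgebra k V, ∀ m n, m ≤ n →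
      a * pathElt k (p m) (r m) = 0 → a * pathElt k (p n) (r n) = 0 := by
    intro a m n hmn h
    induction n, hmn using Nat.le_induction with
    | base => exact h
    | succ n _ ih =>
      obtain ⟨q, hq, hqp⟩ := hext n
      rw [hq, hqp.pathElt_append, ← mul_assoc, ih, zero_mul]
  let I : AddSubgroup (LeavittPathAlgebra k V) :=
    { carrier := {a | ∃ n, a * pathElt k (p n) (r n) = 0}
      zero_mem' := ⟨0, zero_mul _⟩
      add_mem' := by
        rintro a b ⟨m, hm⟩ ⟨n, hn⟩
        refine ⟨max m n, ?_⟩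
        rw [add_mul, mono a m _ (le_max_left m n) hm, mono b n _ (le_max_right m n) hn, add_zero]
      neg_mem' := by
        rintro a ⟨n, hn⟩
        exact ⟨n, by rw [neg_mul, hn, neg_zero]⟩ }
  refine isPrimitiveRing_of_leftIdeal (vtx k x₀) I ?_ ?_ ?_ ?_
  · rintro a b ⟨n, hn⟩
    exact ⟨n, by rw [mul_assoc, hn, mul_zero]⟩
  · rintro ⟨n, hn⟩
    rw [(hp n).vtx_mul_pathElt] at hn
    exact pathElt_ne_zero k (hp n) hn
  · intro a
    exact ⟨0, by rw [sub_mul, mul_assoc, (hp 0).vtx_mul_pathElt, sub_self]⟩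
  · intro a ha
    obtain ⟨b, d, y, hbd⟩ := exists_mul_mul_eq_vtx hL ha
    obtain ⟨n, l, hl⟩ := hcof y
    -- For the path `l` from `y` to the range of `pₙ`, one has `pₙ l* y l pₙ* = pₙ pₙ*`.
    refine ⟨pathElt k (p n) (r n) * ghostElt k l (r n) * b,
      d * pathElt k l (r n) * ghostElt k (p n) (r n), n, ?_⟩
    have h : pathElt k (p n) (r n) * ghostElt k l (r n) * b * a *
        (d * pathElt k l (r n) * ghostElt k (p n) (r n)) =
        pathElt k (p n) (r n) * ghostElt k (p n) (r n) := by
      calc _ = pathElt k (p n) (r n) * (ghostElt k l (r n) * ((b * a * d) * pathElt k l (r n))) *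
            ghostElt k (p n) (r n) := by simp only [mul_assoc]
        _ = _ := by rw [hbd, hl.vtx_mul_pathElt, hl.ghostElt_mul_pathElt_self, pathElt_mul_vtx]
    rw [h, sub_mul, (hp n).vtx_mul_pathElt, mul_assoc, (hp n).ghostElt_mul_pathElt_self,
      pathElt_mul_vtx, sub_self]

end LeavittPathAlgebra

theorem mainTheorem8 (V : Type u) [Quiver.{v} V] [Nonempty V] (k : Type w) [Field k] :
    IsPrimitiveRing (LeavittPathAlgebra k V) ↔
      ConditionL V ∧ IsDownwardDirectedGraph V ∧ CountableSeparationProperty V :=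
  ⟨fun h => ⟨LeavittPathAlgebra.conditionL_of_isPrimitiveRing h,
    LeavittPathAlgebra.isDownwardDirectedGraph_of_isPrimitiveRing h,
    LeavittPathAlgebra.countableSeparationProperty_of_isPrimitiveRing h⟩,
    fun ⟨hL, hdd, hcsp⟩ => LeavittPathAlgebra.isPrimitiveRing_of_graph hL hdd hcsp⟩
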